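/- Let $n\ge 3$ be an integer and let $p,q$ be real numbers with $1<p<\frac{n+2}{n-2}<q$. For a function $f$ and $R>0$, a singular solution on $(0,R)$ of $$u''+\frac{n-1}{r}u'+f(u)=0$$ means a positive function $u\in C^2(0,R)$ satisfying the equation on $(0,R)$ with $\lim_{r\to 0^+}u(r)=\infty$. Put $$B=\frac{2}{(q-1)^2}\bigl[-2+(q-1)(n-2)\bigr],\qquad w_0(r)=B^{\frac1{q-1}}\,r^{-\frac{2}{q-1}}\quad(r>0).$$ Then: 1. The equation $u''+\frac{n-1}{r}u'+u^p+u^q=0$ has a singular solution $W_0$ on some interval $(0,R)$, and it is unique: any two singular solutions, on $(0,R_1)$ and $(0,R_2)$, coincide on $(0,\min(R_1,R_2))$. 2. The function $w_0$ is the unique singular solution of $u''+\frac{n-1}{r}u'+u^q=0$: it is a singular solution on every $(0,R)$, and every singular solution on an interval $(0,R)$ coincides with $w_0$ there. 3. For the singular solution $W_0$ of the equation in 1 (on any $(0,R)$), $$\lim_{r\to 0^+}\frac{W_0(r)}{w_0(r)}=1.$$ -/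

import Mathlib

open Set Filter Topology

/-- `u` is a (positive, classical) singular solution on `(0, R)` of the radial equation
`u'' + ((n - 1) / r) u' + f(u) = 0`: a positive `C²` function on `(0, R)` satisfying the equation
there, with `u(r) → ∞` as `r → 0⁺`. -/
structure IsSingularSolution (n : ℕ) (f : ℝ → ℝ) (R : ℝ) (u : ℝ → ℝ) : Prop where
  radius_pos : 0 < R
  pos : ∀ r ∈ Ioo 0 R, 0 < u r
  contDiffOn : ContDiffOn ℝ 2 u (Ioo 0 R)
  equation : ∀ r ∈ Ioo 0 R,
    deriv (deriv u) r + ((n : ℝ) - 1) / r * deriv u r + f (u r) = 0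
  singular : Tendsto u (𝓝[>] 0) atTop

/-- The constant `B = 2 / (q - 1)² · (-2 + (q - 1)(n - 2))`. -/
noncomputable def laneEmdenB (n : ℕ) (q : ℝ) : ℝ :=
  2 / (q - 1) ^ 2 * (-2 + (q - 1) * ((n : ℝ) - 2))

/-- The function `w₀(r) = B^{1/(q-1)} r^{-2/(q-1)}`. -/
noncomputable def laneEmdenSingular (n : ℕ) (q : ℝ) (r : ℝ) : ℝ :=
  laneEmdenB n q ^ (1 / (q - 1)) * r ^ (-2 / (q - 1))

/-!
Put `θ = 2 / (q - 1)` and `β = n - 2 - θ`. The substitution `v(t) = e^{θt} u(e^t)` turns the radial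
equation into `v'' + (β - θ) v' - θ β v + v ^ q = 0`, up to a perturbation which is exponentially
small as `t → -∞` because `u ^ p` is of lower order; the explicit solution `w₀` is the positive
equilibrium `(θ β) ^ (1 / (q - 1))`.

Since the flux `e^{βt} (v' - θ v)` decreases, `v` and `v'` are bounded at `-∞`. Supercriticality of
`q` says that `θ < β`, so the equation is damped: by Barbalat's lemma applied to the energy, `v'`
and then `θ β v - v ^ q` tend to `0`, and `v` tends to an equilibrium. The limit `0` is excluded
because it would make `u` bounded. This is the asymptotic statement. The difference of two
solutions is therefore asymptotically a damped oscillator at rest at `-∞`, and a Lyapunov function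
shows that it vanishes: this is uniqueness. Existence is a fixed point argument among the bounded
functions close to the equilibrium, where both factors of the linearised operator are inverted by a
convolution.
-/

theorem monotoneOn_of_hasDerivAt_nonneg {D : Set ℝ} {f f' : ℝ → ℝ} (hD : Convex ℝ D)
    (hf : ∀ x ∈ D, HasDerivAt f (f' x) x) (hf' : ∀ x ∈ D, 0 ≤ f' x) : MonotoneOn f D := by
  refine monotoneOn_of_deriv_nonneg hD (fun x hx => (hf x hx).continuousAt.continuousWithinAt)
    (fun x hx => (hf x (interior_subset hx)).differentiableAt.differentiableWithinAt)
    fun x hx => ?_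
  rw [(hf x (interior_subset hx)).deriv]
  exact hf' x (interior_subset hx)

theorem antitoneOn_of_hasDerivAt_nonpos {D : Set ℝ} {f f' : ℝ → ℝ} (hD : Convex ℝ D)
    (hf : ∀ x ∈ D, HasDerivAt f (f' x) x) (hf' : ∀ x ∈ D, f' x ≤ 0) : AntitoneOn f D := by
  have hmono := monotoneOn_of_hasDerivAt_nonneg hD (fun x hx => (hf x hx).neg)
    fun x hx => neg_nonneg.2 (hf' x hx)
  exact fun x hx y hy hxy => neg_le_neg_iff.1 (hmono hx hy hxy)

theorem nonneg_of_hasDerivAt_nonneg_of_eventually_ge {f f' g : ℝ → ℝ} {t : ℝ}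
    (hf : ∀ s ≤ t, HasDerivAt f (f' s) s) (hf' : ∀ s ≤ t, 0 ≤ f' s)
    (hg : Tendsto g atBot (𝓝 0)) (hle : ∀ᶠ s in atBot, g s ≤ f s) : 0 ≤ f t := by
  have hmono : MonotoneOn f (Iic t) := monotoneOn_of_hasDerivAt_nonneg (convex_Iic t) hf hf'
  refine le_of_tendsto hg ?_
  filter_upwards [hle, eventually_le_atBot t] with s hs hst
  exact hs.trans (hmono hst self_mem_Iic hst)

theorem tendsto_exp_mul_atBot {a : ℝ} (ha : 0 < a) :
    Tendsto (fun t : ℝ => Real.exp (a * t)) atBot (𝓝 0) :=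
  Real.tendsto_exp_atBot.comp (tendsto_id.const_mul_atBot ha)

theorem tendsto_exp_neg_mul_mul_const {θ x : ℝ} (hθ : 0 < θ) (hx : 0 < x) :
    Tendsto (fun t => Real.exp (-θ * t) * x) atBot atTop :=
  (Real.tendsto_exp_atTop.comp
    (tendsto_id.const_mul_atBot_of_neg (neg_lt_zero.2 hθ))).atTop_mul_const hx

theorem hasDerivAt_exp_mul (a t : ℝ) :
    HasDerivAt (fun s : ℝ => Real.exp (a * s)) (a * Real.exp (a * t)) t := by
  simpa [mul_comm] using ((hasDerivAt_id t).const_mul a).exp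

/-! ### The Emden–Fowler equation -/

/-- The nonlinearity `f` in the Emden–Fowler variables: `u'' + ((n - 1) / r) u' + f(u) = 0` becomes
`v'' + (β - θ) v' - θ β v + emdenFowlerSource θ f t v = 0`, with `β = n - 2 - θ`, under the
substitution `v(t) = e^{θt} u(e^t)`. -/
noncomputable def emdenFowlerSource (θ : ℝ) (f : ℝ → ℝ) (t x : ℝ) : ℝ :=
  Real.exp ((θ + 2) * t) * f (Real.exp (-θ * t) * x)

/-- `v` is a positive solution, with derivative `w`, of the Emden–Fowler equation
`v'' + (β - θ) v' - θ β v + emdenFowlerSource θ f t v = 0` on `(-∞, T)`, and the function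
`u(e^t) = e^{-θt} v(t)` that it represents is unbounded as `t → -∞`. -/
structure IsEmdenFowlerSolution (θ β : ℝ) (f : ℝ → ℝ) (T : ℝ) (v w : ℝ → ℝ) : Prop where
  pos : ∀ t < T, 0 < v t
  hasDerivAt_fst : ∀ t < T, HasDerivAt v (w t) t
  hasDerivAt_snd : ∀ t < T, HasDerivAt w
    (θ * β * v t - (β - θ) * w t - emdenFowlerSource θ f t (v t)) t
  singular : Tendsto (fun t => Real.exp (-θ * t) * v t) atBot atTop

/-- The parameters of the Emden–Fowler equation of `u'' + ((n - 1) / r) u' + u ^ q = 0` when `q` is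
above the critical exponent `(n + 2) / (n - 2)`: the decay rate `θ = 2 / (q - 1)` of the explicit
singular solution and `β = n - 2 - θ`, the inequality `θ < β` being supercriticality. -/
structure IsSupercritical (θ β q : ℝ) : Prop where
  theta_pos : 0 < θ
  theta_lt : θ < β
  scaling : θ * (q - 1) = 2

theorem IsSupercritical.beta_pos {θ β q : ℝ} (hs : IsSupercritical θ β q) : 0 < β :=
  hs.theta_pos.trans hs.theta_lt

theorem IsSupercritical.one_lt {θ β q : ℝ} (hs : IsSupercritical θ β q) : 1 < q :=
  sub_pos.1 (pos_of_mul_pos_right (hs.scaling ▸ two_pos) hs.theta_pos.le)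

theorem emdenFowlerSource_rpow {θ q x : ℝ} (hθ : θ * (q - 1) = 2) (hx : 0 ≤ x) (t : ℝ) :
    emdenFowlerSource θ (fun u => u ^ q) t x = x ^ q := by
  have hexp : (θ + 2) * t + -θ * t * q = 0 := by linear_combination -t * hθ
  rw [emdenFowlerSource, Real.mul_rpow (Real.exp_pos _).le hx, ← Real.exp_mul, ← mul_assoc,
    ← Real.exp_add, hexp, Real.exp_zero, one_mul]

namespace IsEmdenFowlerSolution

variable {θ β T : ℝ} {f v w : ℝ → ℝ}

theorem mono {T' : ℝ} (h : IsEmdenFowlerSolution θ β f T v w) (hT : T' ≤ T) :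
    IsEmdenFowlerSolution θ β f T' v w where
  pos t ht := h.pos t (ht.trans_le hT)
  hasDerivAt_fst t ht := h.hasDerivAt_fst t (ht.trans_le hT)
  hasDerivAt_snd t ht := h.hasDerivAt_snd t (ht.trans_le hT)
  singular := h.singular

theorem eventually_pos (h : IsEmdenFowlerSolution θ β f T v w) : ∀ᶠ t in atBot, 0 < v t :=
  (eventually_lt_atBot T).mono h.pos

theorem hasDerivAt_exp_mul_fst (h : IsEmdenFowlerSolution θ β f T v w) (b : ℝ) {t : ℝ}
    (ht : t < T) : HasDerivAt (fun s => Real.exp (b * s) * v s)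
      (Real.exp (b * t) * (w t + b * v t)) t := by
  refine ((hasDerivAt_exp_mul b t).mul (h.hasDerivAt_fst t ht)).congr_deriv ?_
  ring

theorem hasDerivAt_exp_mul_flux (h : IsEmdenFowlerSolution θ β f T v w) (b : ℝ) {t : ℝ}
    (ht : t < T) : HasDerivAt (fun s => Real.exp (b * s) * (w s - θ * v s))
      (Real.exp (b * t) * ((b - β) * (w t - θ * v t) - emdenFowlerSource θ f t (v t))) t := by
  refine ((hasDerivAt_exp_mul b t).mul ((h.hasDerivAt_snd t ht).sub
    ((h.hasDerivAt_fst t ht).const_mul θ))).congr_deriv ?_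
  simp only [Pi.sub_apply]
  ring

theorem source_pos (h : IsEmdenFowlerSolution θ β f T v w) (hf : ∀ x, 0 < x → 0 < f x) {t : ℝ}
    (ht : t < T) : 0 < emdenFowlerSource θ f t (v t) :=
  mul_pos (Real.exp_pos _) (hf _ (mul_pos (Real.exp_pos _) (h.pos t ht)))

theorem antitoneOn_flux (h : IsEmdenFowlerSolution θ β f T v w) (hf : ∀ x, 0 < x → 0 < f x) :
    AntitoneOn (fun s => Real.exp (β * s) * (w s - θ * v s)) (Iio T) := by
  refine antitoneOn_of_hasDerivAt_nonpos (convex_Iio T)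
    (fun s hs => h.hasDerivAt_exp_mul_flux β hs) fun s hs => ?_
  rw [sub_self, zero_mul, zero_sub]
  exact mul_nonpos_of_nonneg_of_nonpos (Real.exp_pos _).le
    (neg_nonpos.2 (h.source_pos hf hs).le)

theorem deriv_lt (h : IsEmdenFowlerSolution θ β f T v w) (hf : ∀ x, 0 < x → 0 < f x) {t : ℝ}
    (ht : t < T) : w t < θ * v t := by
  by_contra! hcon
  have hflux : ∀ s ≤ t, 0 ≤ w s - θ * v s := fun s hst => by
    have hanti := h.antitoneOn_flux hf (hst.trans_lt ht) ht hst
    have hnonneg : 0 ≤ Real.exp (β * t) * (w t - θ * v t) :=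
      mul_nonneg (Real.exp_pos _).le (sub_nonneg.2 hcon)
    exact nonneg_of_mul_nonneg_right (hnonneg.trans hanti) (Real.exp_pos _)
  have hmono : MonotoneOn (fun s => Real.exp (-θ * s) * v s) (Iic t) :=
    monotoneOn_of_hasDerivAt_nonneg (convex_Iic t)
      (fun s hs => h.hasDerivAt_exp_mul_fst (-θ) (lt_of_le_of_lt hs ht)) fun s hs =>
      mul_nonneg (Real.exp_pos _).le (by linarith [hflux s hs])
  obtain ⟨s, hlarge, hst⟩ := ((h.singular.eventually_gt_atTop (Real.exp (-θ * t) * v t)).and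
    (eventually_le_atBot t)).exists
  exact absurd hlarge (not_lt.2 (hmono hst self_mem_Iic hst))

theorem antitoneOn_exp_mul_fst (h : IsEmdenFowlerSolution θ β f T v w)
    (hf : ∀ x, 0 < x → 0 < f x) : AntitoneOn (fun s => Real.exp (-θ * s) * v s) (Iio T) :=
  antitoneOn_of_hasDerivAt_nonpos (convex_Iio T) (fun s hs => h.hasDerivAt_exp_mul_fst (-θ) hs)
    fun s hs => mul_nonpos_of_nonneg_of_nonpos (Real.exp_pos _).le (by linarith [h.deriv_lt hf hs])

theorem source_div_le {g : ℝ → ℝ} (h : IsEmdenFowlerSolution θ β f T v w) (hb : 0 < β + (θ + 2))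
    (hg : MonotoneOn g (Ioi 0)) (hg0 : ∀ x, 0 < x → 0 < g x) (hgf : ∀ x, 0 < x → g x ≤ f x)
    {t : ℝ} (ht : t < T) :
    emdenFowlerSource θ g t (v t) / (β + (θ + 2)) ≤ θ * v t - w t := by
  have hf0 : ∀ x, 0 < x → 0 < f x := fun x hx => (hg0 x hx).trans_le (hgf x hx)
  set b := β + (θ + 2) with hb_def
  set U : ℝ → ℝ := fun s => Real.exp (-θ * s) * v s
  have hUpos : ∀ s < T, 0 < U s := fun s hs => mul_pos (Real.exp_pos _) (h.pos s hs)
  have hsource : ∀ s ≤ t,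
      Real.exp (b * s) * g (U t) ≤ Real.exp (β * s) * emdenFowlerSource θ f s (v s) := by
    intro s hst
    have hsT := hst.trans_lt ht
    have hle : g (U t) ≤ f (U s) := (hg (hUpos t ht) (hUpos s hsT)
      (h.antitoneOn_exp_mul_fst hf0 hsT ht hst)).trans (hgf _ (hUpos s hsT))
    rw [emdenFowlerSource, ← mul_assoc, ← Real.exp_add, ← add_mul]
    exact mul_le_mul_of_nonneg_left hle (Real.exp_pos _).le
  have hnonneg := nonneg_of_hasDerivAt_nonneg_of_eventually_ge (t := t)
    (f := fun s => -(Real.exp (β * s) * (w s - θ * v s)) - g (U t) / b * Real.exp (b * s))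
    (fun s hs => (h.hasDerivAt_exp_mul_flux β (hs.trans_lt ht)).neg.sub
      ((hasDerivAt_exp_mul b s).const_mul _))
    (fun s hs => by
      have hcancel : g (U t) / b * (b * Real.exp (b * s)) = Real.exp (b * s) * g (U t) := by
        field_simp
      rw [hcancel]
      linarith [hsource s hs])
    (g := fun s => -(g (U t) / b) * Real.exp (b * s))
    (by simpa using (tendsto_exp_mul_atBot hb).const_mul (-(g (U t) / b)))
    (by
      filter_upwards [eventually_lt_atBot T] with s hs
      have := mul_neg_of_pos_of_neg (Real.exp_pos (β * s)) (sub_neg.2 (h.deriv_lt hf0 hs))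
      linarith)
  have hsplit : g (U t) / b * Real.exp (b * t) =
      Real.exp (β * t) * (emdenFowlerSource θ g t (v t) / b) := by
    rw [emdenFowlerSource, hb_def, add_mul, Real.exp_add]
    ring
  refine le_of_mul_le_mul_left ?_ (Real.exp_pos (β * t))
  linarith

end IsEmdenFowlerSolution

section Supercritical

variable {θ β q T : ℝ} {f v w : ℝ → ℝ}

namespace IsEmdenFowlerSolution

theorem rpow_div_le (hs : IsSupercritical θ β q) (hf : ∀ x, 0 < x → x ^ q ≤ f x)
    (h : IsEmdenFowlerSolution θ β f T v w) {t : ℝ} (ht : t < T) :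
    v t ^ q / (β + (θ + 2)) ≤ θ * v t - w t := by
  rw [← emdenFowlerSource_rpow hs.scaling (h.pos t ht).le t]
  exact h.source_div_le (by linarith [hs.theta_pos, hs.beta_pos])
    (fun x hx y _ hxy => Real.rpow_le_rpow (le_of_lt hx) hxy (by linarith [hs.one_lt]))
    (fun x hx => Real.rpow_pos_of_pos hx q) hf ht

theorem source_lower (hs : IsSupercritical θ β q) (hf : ∀ x, 0 < x → x ^ q ≤ f x)
    (h : IsEmdenFowlerSolution θ β f T v w) {t : ℝ} (ht : t < T) :
    (q - 1) / (β + (θ + 2)) ≤ (q - 1) * v t ^ (-q) * (θ * v t - w t) := by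
  have hv := h.pos t ht
  have hq : 0 < q - 1 := sub_pos.2 hs.one_lt
  have hone : v t ^ (-q) * v t ^ q = 1 := by rw [← Real.rpow_add hv, neg_add_cancel, Real.rpow_zero]
  calc (q - 1) / (β + (θ + 2)) = (q - 1) * v t ^ (-q) * (v t ^ q / (β + (θ + 2))) := by
        linear_combination -(q - 1) / (β + (θ + 2)) * hone
    _ ≤ _ := mul_le_mul_of_nonneg_left (h.rpow_div_le hs hf ht) (by positivity)

/-- The flux bound makes `v ^ (1 - q)` a supersolution of a linear equation. -/
theorem exists_fst_le (hs : IsSupercritical θ β q) (hf : ∀ x, 0 < x → x ^ q ≤ f x)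
    (h : IsEmdenFowlerSolution θ β f T v w) : ∃ M, ∀ t < T, v t ≤ M := by
  have hq : 0 < q - 1 := sub_pos.2 hs.one_lt
  have hb : 0 < β + (θ + 2) := by linarith [hs.theta_pos, hs.beta_pos]
  set k := (q - 1) / (β + (θ + 2)) / 2 with hk
  have hk0 : 0 < k := by positivity
  have hderiv : ∀ t < T, HasDerivAt (fun s => Real.exp (2 * s) * (v s ^ (1 - q) - k))
      (Real.exp (2 * t) *
        ((q - 1) * v t ^ (-q) * (θ * v t - w t) - (q - 1) / (β + (θ + 2)))) t := by
    intro t ht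
    have hv := h.pos t ht
    refine ((hasDerivAt_exp_mul 2 t).mul (((h.hasDerivAt_fst t ht).rpow_const
      (p := 1 - q) (Or.inl hv.ne')).sub_const k)).congr_deriv ?_
    rw [show 1 - q - 1 = -q by ring, sub_eq_neg_add 1 q, Real.rpow_add_one hv.ne', hk]
    linear_combination -Real.exp (2 * t) * v t ^ (-q) * v t * hs.scaling
  have hle : ∀ t < T, k ≤ v t ^ (1 - q) := fun t ht => by
    have hnonneg := nonneg_of_hasDerivAt_nonneg_of_eventually_ge (t := t)
      (fun s hst => hderiv s (hst.trans_lt ht))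
      (fun s hst => mul_nonneg (Real.exp_pos _).le
        (sub_nonneg.2 (h.source_lower hs hf (hst.trans_lt ht))))
      (g := fun s => -k * Real.exp (2 * s))
      (by simpa using (tendsto_exp_mul_atBot (two_pos : (0 : ℝ) < 2)).const_mul (-k))
      (by
        filter_upwards [h.eventually_pos] with s hs
        linarith [mul_pos (Real.exp_pos (2 * s)) (Real.rpow_pos_of_pos hs (1 - q))])
    exact sub_nonneg.1 (nonneg_of_mul_nonneg_right hnonneg (Real.exp_pos _))
  refine ⟨k ^ (1 / (1 - q)), fun t ht => ?_⟩
  have hroot := Real.rpow_le_rpow_of_nonpos hk0 (hle t ht) (z := 1 / (1 - q))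
    (one_div_nonpos.2 (by linarith))
  rwa [← Real.rpow_mul (h.pos t ht).le, mul_one_div_cancel (by linarith), Real.rpow_one] at hroot

theorem isBigO_fst (hs : IsSupercritical θ β q) (hf : ∀ x, 0 < x → x ^ q ≤ f x)
    (h : IsEmdenFowlerSolution θ β f T v w) : v =O[atBot] (fun _ => (1 : ℝ)) := by
  obtain ⟨M, hM⟩ := h.exists_fst_le hs hf
  refine Asymptotics.IsBigO.of_bound M ?_
  filter_upwards [eventually_lt_atBot T] with t ht
  rw [norm_one, mul_one, Real.norm_eq_abs, abs_of_pos (h.pos t ht)]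
  exact hM t ht

/-- On `(t, t + 1)` the mean value theorem gives a point where `w ≥ -M`; the monotonicity of the
flux carries this bound back to `t`. -/
theorem isBigO_snd (hs : IsSupercritical θ β q) (hf : ∀ x, 0 < x → x ^ q ≤ f x)
    (h : IsEmdenFowlerSolution θ β f T v w) : w =O[atBot] (fun _ => (1 : ℝ)) := by
  obtain ⟨M, hM⟩ := h.exists_fst_le hs hf
  have hf0 : ∀ x, 0 < x → 0 < f x := fun x hx => (Real.rpow_pos_of_pos hx q).trans_le (hf x hx)
  have hθ := hs.theta_pos
  refine Asymptotics.IsBigO.of_bound (θ * M + Real.exp β * ((1 + θ) * M)) ?_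
  filter_upwards [eventually_lt_atBot (T - 1)] with t ht
  have htT : t < T := by linarith
  have hM0 : 0 < M := (h.pos t htT).trans_le (hM t htT)
  obtain ⟨ξ, ⟨htξ, hξt⟩, hslope⟩ := exists_hasDerivAt_eq_slope v w (lt_add_one t)
    (fun s hs => (h.hasDerivAt_fst s (by linarith [hs.2])).continuousAt.continuousWithinAt)
    (fun s hs => h.hasDerivAt_fst s (by linarith [hs.2]))
  have hξT : ξ < T := by linarith
  have hwξ : -((1 + θ) * M) ≤ w ξ - θ * v ξ := by
    rw [add_sub_cancel_left, div_one] at hslope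
    nlinarith [h.pos (t + 1) (by linarith), hM t htT, hM ξ hξT]
  have hflux : -(Real.exp β * ((1 + θ) * M)) ≤ w t - θ * v t := by
    have hanti := h.antitoneOn_flux hf0 htT hξT htξ.le
    have hexp : Real.exp (β * ξ) ≤ Real.exp (β * t) * Real.exp β := by
      rw [← Real.exp_add]
      exact Real.exp_le_exp.2 (by nlinarith [hs.beta_pos])
    refine le_of_mul_le_mul_left ?_ (Real.exp_pos (β * t))
    calc Real.exp (β * t) * -(Real.exp β * ((1 + θ) * M))
        = -(Real.exp (β * t) * Real.exp β * ((1 + θ) * M)) := by ring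
      _ ≤ -(Real.exp (β * ξ) * ((1 + θ) * M)) :=
        neg_le_neg (mul_le_mul_of_nonneg_right hexp (by positivity))
      _ ≤ Real.exp (β * ξ) * (w ξ - θ * v ξ) := by
        nlinarith [Real.exp_pos (β * ξ)]
      _ ≤ _ := hanti
  have hupper : θ * v t ≤ θ * M := mul_le_mul_of_nonneg_left (hM t htT) hθ.le
  have hvpos : 0 < θ * v t := mul_pos hθ (h.pos t htT)
  have hpos : 0 < Real.exp β * ((1 + θ) * M) := by positivity
  rw [norm_one, mul_one, Real.norm_eq_abs, abs_le]
  constructor <;> linarith [h.deriv_lt hf0 htT]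

end IsEmdenFowlerSolution

end Supercritical

/-! ### Asymptotics at `-∞` -/

theorem isBigO_exp_mul_atBot {a b : ℝ} (hab : a ≤ b) :
    (fun t : ℝ => Real.exp (b * t)) =O[atBot] fun t => Real.exp (a * t) := by
  refine Asymptotics.IsBigO.of_bound 1 ?_
  filter_upwards [eventually_le_atBot 0] with t ht
  rw [one_mul, Real.norm_of_nonneg (Real.exp_pos _).le, Real.norm_of_nonneg (Real.exp_pos _).le]
  exact Real.exp_le_exp.2 (mul_le_mul_of_nonpos_right hab ht)

theorem tendsto_exp_mul_mul_atBot {a : ℝ} (ha : 0 < a) {f : ℝ → ℝ}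
    (hf : f =O[atBot] fun _ => (1 : ℝ)) :
    Tendsto (fun t => Real.exp (a * t) * f t) atBot (𝓝 0) := by
  have hexp := (Asymptotics.isLittleO_one_iff ℝ).2 (tendsto_exp_mul_atBot ha)
  exact (Asymptotics.isLittleO_one_iff ℝ).1 (by simpa using hexp.mul_isBigO hf)

/-- Barbalat's lemma at `-∞`. -/
theorem tendsto_zero_of_tendsto_of_hasDerivAt_add {F g g' e : ℝ → ℝ} {l : ℝ}
    (hF : ∀ᶠ t in atBot, HasDerivAt F (g t + e t) t) (hFl : Tendsto F atBot (𝓝 l))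
    (he : Tendsto e atBot (𝓝 0)) (hg : ∀ᶠ t in atBot, HasDerivAt g (g' t) t)
    (hg' : g' =O[atBot] fun _ => (1 : ℝ)) : Tendsto g atBot (𝓝 0) := by
  obtain ⟨K, hK, hbound⟩ := hg'.exists_pos
  rw [Metric.tendsto_nhds]
  intro ε hε
  set τ := ε / (3 * K) with hτ_def
  have hτ : 0 < τ := by positivity
  have hKτ : K * τ = ε / 3 := by rw [hτ_def]; field_simp
  have hdiff : Tendsto (fun t => F t - F (t - τ)) atBot (𝓝 0) := by
    simpa [sub_eq_add_neg] using
      hFl.sub (hFl.comp (tendsto_atBot_add_const_right _ (-τ) tendsto_id))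
  obtain ⟨N, hN⟩ := eventually_atBot.1 (hF.and (hg.and (hbound.bound.and
    ((Metric.tendsto_nhds.1 he (ε / 3) (by positivity)).and
      (Metric.tendsto_nhds.1 hdiff (τ * (ε / 3)) (by positivity))))))
  filter_upwards [eventually_le_atBot N] with t htN
  obtain ⟨ξ, ⟨hτξ, hξt⟩, hFξ⟩ := exists_hasDerivAt_eq_slope F (fun s => g s + e s)
    (sub_lt_self t hτ) (fun s hs => (hN s (hs.2.trans htN)).1.continuousAt.continuousWithinAt)
    (fun s hs => (hN s (hs.2.le.trans htN)).1)
  obtain ⟨η, ⟨_, hηt⟩, hgη⟩ := exists_hasDerivAt_eq_slope g g' hξt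
    (fun s hs => (hN s (hs.2.trans htN)).2.1.continuousAt.continuousWithinAt)
    (fun s hs => (hN s (hs.2.le.trans htN)).2.1)
  obtain ⟨-, -, -, heξ, -⟩ := hN ξ (hξt.le.trans htN)
  obtain ⟨-, -, hg'η, -, -⟩ := hN η (hηt.le.trans htN)
  obtain ⟨-, -, -, -, hdiff_t⟩ := hN t htN
  simp only [Real.dist_eq, sub_zero, norm_one, mul_one, Real.norm_eq_abs] at heξ hg'η hdiff_t ⊢
  have hgξ : |g t - g ξ| ≤ ε / 3 := by
    rw [eq_div_iff (sub_pos.2 hξt).ne'] at hgη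
    rw [← hgη, abs_mul, abs_of_pos (sub_pos.2 hξt), ← hKτ]
    exact mul_le_mul hg'η (by linarith) (sub_pos.2 hξt).le hK.le
  have hsum : |g ξ + e ξ| < ε / 3 := by
    rw [hFξ, sub_sub_cancel, abs_div, abs_of_pos hτ, div_lt_iff₀ hτ]
    linarith
  rw [abs_lt] at heξ hsum ⊢
  rw [abs_le] at hgξ
  constructor <;> linarith

theorem exists_tendsto_atBot_of_antitoneOn_Iic {F : ℝ → ℝ} {N K : ℝ} (hF : AntitoneOn F (Iic N))
    (hK : ∀ t ≤ N, F t ≤ K) : ∃ l, Tendsto F atBot (𝓝 l) := by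
  have hanti : Antitone fun t => F (min t N) := fun a b hab =>
    hF (min_le_right a N) (min_le_right b N) (min_le_min_right _ hab)
  refine ⟨_, (tendsto_atBot_ciSup hanti ⟨K, ?_⟩).congr' ?_⟩
  · rintro _ ⟨t, rfl⟩
    exact hK _ (min_le_right _ _)
  · filter_upwards [eventually_le_atBot N] with t ht
    rw [min_eq_left ht]

theorem exists_tendsto_atBot_of_hasDerivAt_le_exp {E E' : ℝ → ℝ} {C δ : ℝ} (hδ : 0 < δ)
    (hE : ∀ᶠ t in atBot, HasDerivAt E (E' t) t) (hE' : ∀ᶠ t in atBot, E' t ≤ C * Real.exp (δ * t))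
    (hbdd : E =O[atBot] fun _ => (1 : ℝ)) : ∃ l, Tendsto E atBot (𝓝 l) := by
  have hexp : Tendsto (fun t => C / δ * Real.exp (δ * t)) atBot (𝓝 0) := by
    simpa using (tendsto_exp_mul_atBot hδ).const_mul (C / δ)
  obtain ⟨K, hK⟩ := (hbdd.sub (hexp.isBigO_one ℝ)).bound
  obtain ⟨N, hN⟩ := eventually_atBot.1 (hE.and (hE'.and hK))
  have hanti : AntitoneOn (fun t => E t - C / δ * Real.exp (δ * t)) (Iic N) :=
    antitoneOn_of_hasDerivAt_nonpos (convex_Iic N)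
      (fun t ht => (hN t ht).1.sub ((hasDerivAt_exp_mul δ t).const_mul _)) fun t ht => by
        rw [← mul_assoc, div_mul_cancel₀ _ hδ.ne']
        exact sub_nonpos.2 (hN t ht).2.1
  obtain ⟨l, hl⟩ := exists_tendsto_atBot_of_antitoneOn_Iic hanti (K := K) fun t ht => by
    simpa using (le_abs_self _).trans (hN t ht).2.2
  exact ⟨l, by simpa using hl.add hexp⟩

theorem eventually_lt_or_eventually_gt_atBot {v : ℝ → ℝ} {m : ℝ}
    (hcont : ∀ᶠ t in atBot, ContinuousAt v t) (hne : ∀ᶠ t in atBot, v t ≠ m) :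
    (∀ᶠ t in atBot, v t < m) ∨ ∀ᶠ t in atBot, m < v t := by
  obtain ⟨N, hN⟩ := eventually_atBot.1 (hcont.and hne)
  have himage : IsPreconnected (v '' Iic N) := isPreconnected_Iic.image v
    fun t ht => (hN t ht).1.continuousWithinAt
  have hcover : v '' Iic N ⊆ Iio m ∪ Ioi m := by
    rintro _ ⟨t, ht, rfl⟩
    exact (hN t ht).2.lt_or_gt
  refine (himage.subset_or_subset isOpen_Iio isOpen_Ioi Iio_disjoint_Ioi_same hcover).imp
    (fun hsub => ?_) fun hsub => ?_
  all_goals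
    filter_upwards [eventually_le_atBot N] with t ht
    exact hsub (mem_image_of_mem v ht)

theorem tendsto_zero_or_tendsto_rpow_of_balance {v : ℝ → ℝ} {b s : ℝ} (hb : 0 < b) (hs : 0 < s)
    (hpos : ∀ᶠ t in atBot, 0 < v t) (hcont : ∀ᶠ t in atBot, ContinuousAt v t)
    (hbal : Tendsto (fun t => v t * (b - v t ^ s)) atBot (𝓝 0)) :
    Tendsto v atBot (𝓝 0) ∨ Tendsto v atBot (𝓝 (b ^ (1 / s))) := by
  set m := (b / 2) ^ (1 / s) with hm_def
  have hm : 0 < m := by positivity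
  have hms : m ^ s = b / 2 := by
    rw [hm_def, ← Real.rpow_mul (by positivity), one_div_mul_cancel hs.ne', Real.rpow_one]
  have hne : ∀ᶠ t in atBot, v t ≠ m := by
    filter_upwards [hbal.eventually_lt_const (show 0 < m * (b / 2) by positivity)] with t ht hcon
    rw [hcon, hms, sub_half] at ht
    exact ht.false
  refine (eventually_lt_or_eventually_gt_atBot hcont hne).imp (fun hlt => ?_) fun hgt => ?_
  · have hbal' : Tendsto (fun t => v t * (b - v t ^ s) / (b / 2)) atBot (𝓝 0) := by
      simpa using hbal.div_const (b / 2)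
    refine squeeze_zero' (hpos.mono fun t ht => ht.le) ?_ hbal'
    filter_upwards [hpos, hlt] with t ht htm
    have hpow : v t ^ s ≤ b / 2 := hms ▸ Real.rpow_le_rpow ht.le htm.le hs.le
    rw [le_div_iff₀ (by positivity)]
    exact mul_le_mul_of_nonneg_left (by linarith) ht.le
  · have hbal' : Tendsto (fun t => |v t * (b - v t ^ s)| / m) atBot (𝓝 0) := by
      simpa using hbal.abs.div_const m
    have hpow : Tendsto (fun t => v t ^ s) atBot (𝓝 b) := by
      rw [tendsto_iff_norm_sub_tendsto_zero]
      refine squeeze_zero' (Eventually.of_forall fun t => norm_nonneg _) ?_ hbal'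
      filter_upwards [hgt] with t htm
      rw [le_div_iff₀ hm, abs_mul, abs_of_pos (hm.trans htm), mul_comm, Real.norm_eq_abs,
        abs_sub_comm]
      exact mul_le_mul_of_nonneg_right htm.le (abs_nonneg _)
    refine (hpow.rpow_const (p := 1 / s) (Or.inl hb.ne')).congr' ?_
    filter_upwards [hpos] with t ht
    rw [← Real.rpow_mul ht.le, mul_one_div_cancel hs.ne', Real.rpow_one]

namespace IsEmdenFowlerSolution

variable {θ β T : ℝ} {f v w : ℝ → ℝ}

theorem isBigO_exp_of_source_le {a : ℝ} (h : IsEmdenFowlerSolution θ β f T v w) (haβ : a < β)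
    (hv : v =O[atBot] fun _ => (1 : ℝ)) (hw : w =O[atBot] fun _ => (1 : ℝ))
    (hsource : ∀ᶠ t in atBot, emdenFowlerSource θ f t (v t) ≤ a * (β - a + θ) * v t) :
    v =O[atBot] fun t => Real.exp ((θ - a) * t) := by
  obtain ⟨N, hN⟩ := eventually_atBot.1 (hsource.and (eventually_lt_atBot T))
  have hderiv : ∀ t ≤ N, (θ - a) * v t ≤ w t := fun t htN => by
    have hnonneg := nonneg_of_hasDerivAt_nonneg_of_eventually_ge (t := t)
      (f := fun s => Real.exp ((β - a) * s) * (w s - θ * v s) +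
        a * (Real.exp ((β - a) * s) * v s))
      (fun s hs => (h.hasDerivAt_exp_mul_flux (β - a) (hN s (hs.trans htN)).2).add
        ((h.hasDerivAt_exp_mul_fst (β - a) (hN s (hs.trans htN)).2).const_mul a))
      (fun s hs => by
        nlinarith [Real.exp_pos ((β - a) * s), (hN s (hs.trans htN)).1])
      (tendsto_exp_mul_mul_atBot (sub_pos.2 haβ)
        (f := fun s => w s - θ * v s + a * v s)
        ((hw.sub (hv.const_mul_left θ)).add (hv.const_mul_left a)))
      (Eventually.of_forall fun s => le_of_eq (by ring))
    have hfactor : Real.exp ((β - a) * t) * (w t - θ * v t) + a * (Real.exp ((β - a) * t) * v t) =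
        Real.exp ((β - a) * t) * (w t - (θ - a) * v t) := by ring
    exact sub_nonneg.1 (nonneg_of_mul_nonneg_right (hfactor ▸ hnonneg) (Real.exp_pos _))
  have hmono : MonotoneOn (fun s => Real.exp (-(θ - a) * s) * v s) (Iic N) :=
    monotoneOn_of_hasDerivAt_nonneg (convex_Iic N)
      (fun t ht => h.hasDerivAt_exp_mul_fst (-(θ - a)) (hN t ht).2)
      (fun t ht => mul_nonneg (Real.exp_pos _).le (by linarith [hderiv t ht]))
  refine Asymptotics.IsBigO.of_bound (Real.exp (-(θ - a) * N) * v N) ?_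
  filter_upwards [eventually_le_atBot N] with t htN
  rw [Real.norm_of_nonneg (h.pos t (hN t htN).2).le, Real.norm_of_nonneg (Real.exp_pos _).le,
    ← div_le_iff₀ (Real.exp_pos _), div_eq_inv_mul, ← Real.exp_neg, ← neg_mul]
  exact hmono htN self_mem_Iic htN

theorem exists_mul_fst_sub_le_exp {c : ℝ} (h : IsEmdenFowlerSolution θ β f T v w) (hβ : 0 < β)
    (hb : 0 < β + (θ + c)) (hv : v =O[atBot] fun _ => (1 : ℝ))
    (hw : w =O[atBot] fun _ => (1 : ℝ))
    (hsource : (fun t => emdenFowlerSource θ f t (v t)) =O[atBot]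
      fun t => Real.exp ((θ + c) * t)) :
    ∃ K, ∀ᶠ t in atBot, θ * v t - w t ≤ K * Real.exp ((θ + c) * t) := by
  obtain ⟨C, hC⟩ := hsource.bound
  obtain ⟨N, hN⟩ := eventually_atBot.1 (hC.and (eventually_lt_atBot T))
  set b := β + (θ + c) with hb_def
  have hexp : ∀ s, Real.exp (b * s) = Real.exp (β * s) * Real.exp ((θ + c) * s) := fun s => by
    rw [hb_def, add_mul, Real.exp_add]
  refine ⟨C / b, (eventually_le_atBot N).mono fun t htN => ?_⟩
  have hnonneg := nonneg_of_hasDerivAt_nonneg_of_eventually_ge (t := t)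
    (f := fun s => Real.exp (β * s) * (w s - θ * v s) + C / b * Real.exp (b * s))
    (fun s hs => (h.hasDerivAt_exp_mul_flux β (hN s (hs.trans htN)).2).add
      ((hasDerivAt_exp_mul b s).const_mul (C / b)))
    (fun s hs => by
      have hle := (le_abs_self _).trans (hN s (hs.trans htN)).1
      rw [Real.norm_of_nonneg (Real.exp_pos _).le] at hle
      rw [← mul_assoc, div_mul_cancel₀ _ hb.ne', hexp]
      nlinarith [Real.exp_pos (β * s)])
    (by
      simpa using (tendsto_exp_mul_mul_atBot hβ (hw.sub (hv.const_mul_left θ))).add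
        ((tendsto_exp_mul_atBot hb).const_mul (C / b)))
    (Eventually.of_forall fun s => le_rfl)
  rw [hexp] at hnonneg
  refine le_of_mul_le_mul_left ?_ (Real.exp_pos (β * t))
  linarith

/-- Such a fast decay of the source would make `e^{-θt} v`, the solution of the radial equation,
bounded. -/
theorem not_source_isBigO_exp {c : ℝ} (h : IsEmdenFowlerSolution θ β f T v w) (hβ : 0 < β)
    (hθ : 0 ≤ θ) (hc : 0 < c) (hv : v =O[atBot] fun _ => (1 : ℝ))
    (hw : w =O[atBot] fun _ => (1 : ℝ)) :
    ¬ (fun t => emdenFowlerSource θ f t (v t)) =O[atBot] fun t => Real.exp ((θ + c) * t) := by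
  intro hsource
  obtain ⟨K, hK⟩ := h.exists_mul_fst_sub_le_exp hβ (by positivity) hv hw hsource
  obtain ⟨N, hN⟩ := eventually_atBot.1 (hK.and (eventually_lt_atBot T))
  have hmono : MonotoneOn (fun s => Real.exp (-θ * s) * v s + K / c * Real.exp (c * s)) (Iic N) :=
    monotoneOn_of_hasDerivAt_nonneg (convex_Iic N)
      (fun t ht => (h.hasDerivAt_exp_mul_fst (-θ) (hN t ht).2).add
        ((hasDerivAt_exp_mul c t).const_mul (K / c))) fun t ht => by
      have hexp : Real.exp (c * t) = Real.exp (-θ * t) * Real.exp ((θ + c) * t) := by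
        rw [← Real.exp_add]
        ring_nf
      rw [← mul_assoc, div_mul_cancel₀ _ hc.ne', hexp]
      nlinarith [Real.exp_pos (-θ * t), (hN t ht).1]
  have hlim := h.singular.atTop_add ((tendsto_exp_mul_atBot hc).const_mul (K / c))
  obtain ⟨s, hlarge, hsN⟩ := ((hlim.eventually_gt_atTop
    (Real.exp (-θ * N) * v N + K / c * Real.exp (c * N))).and (eventually_le_atBot N)).exists
  exact absurd hlarge (not_lt.2 (hmono hsN self_mem_Iic hsN))

end IsEmdenFowlerSolution

/-! ### Lower order perturbations -/

theorem isBigO_rpow_of_deriv_isBigO_rpow {f : ℝ → ℝ} {s : ℝ} (hs : 1 ≤ s)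
    (hf : ∀ᶠ x in atTop, DifferentiableAt ℝ f x)
    (hf' : deriv f =O[atTop] fun x => x ^ (s - 1)) : f =O[atTop] fun x => x ^ s := by
  obtain ⟨C, hC, hbound⟩ := hf'.exists_nonneg
  obtain ⟨x₀, hx₀⟩ := eventually_atTop.1 ((hf.and hbound.bound).and (eventually_ge_atTop 1))
  have hx₀1 : 1 ≤ x₀ := (hx₀ x₀ le_rfl).2
  refine Asymptotics.IsBigO.of_bound (C + |f x₀|) ?_
  filter_upwards [eventually_ge_atTop x₀] with x hx
  have hx1 : 1 ≤ x := hx₀1.trans hx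
  have hx0 : 0 < x := one_pos.trans_le hx1
  have hmvt : ‖f x - f x₀‖ ≤ C * x ^ (s - 1) * ‖x - x₀‖ := by
    refine (convex_Icc x₀ x).norm_image_sub_le_of_norm_deriv_le
      (fun y hy => (hx₀ y hy.1).1.1) (fun y hy => (hx₀ y hy.1).1.2.trans ?_)
      (left_mem_Icc.2 hx) (right_mem_Icc.2 hx)
    have hy0 : 0 ≤ y := (zero_le_one.trans hx₀1).trans hy.1
    rw [Real.norm_of_nonneg (Real.rpow_nonneg hy0 _)]
    exact mul_le_mul_of_nonneg_left (Real.rpow_le_rpow hy0 hy.2 (sub_nonneg.2 hs)) hC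
  have hgrowth : C * x ^ (s - 1) * ‖x - x₀‖ ≤ C * x ^ s := by
    have hsplit : x ^ s = x ^ (s - 1) * x := by
      rw [← Real.rpow_add_one hx0.ne', sub_add_cancel]
    rw [Real.norm_of_nonneg (sub_nonneg.2 hx), hsplit, mul_assoc]
    gcongr
    linarith
  have hconst : |f x₀| ≤ |f x₀| * x ^ s :=
    le_mul_of_one_le_right (abs_nonneg _) (Real.one_le_rpow hx1 (by linarith))
  have htri : |f x| ≤ |f x - f x₀| + |f x₀| := by simpa using abs_add_le (f x - f x₀) (f x₀)
  rw [Real.norm_eq_abs] at hmvt ⊢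
  rw [Real.norm_of_nonneg (Real.rpow_nonneg hx0.le _)]
  linarith

/-- `φ` is a nonnegative `C¹` perturbation of `u ^ q` whose derivative grows more slowly than that
of `u ^ q`, in the polynomial scale. -/
structure IsLowerOrder (q : ℝ) (φ : ℝ → ℝ) : Prop where
  nonneg : ∀ x, 0 < x → 0 ≤ φ x
  contDiffOn : ContDiffOn ℝ 1 φ (Ioi 0)
  deriv_isBigO : ∃ s ∈ Ico 1 q, deriv φ =O[atTop] fun x => x ^ (s - 1)

theorem isLowerOrder_rpow {p q : ℝ} (hq : 1 < q) (hpq : p < q) :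
    IsLowerOrder q fun u => u ^ p where
  nonneg x hx := Real.rpow_nonneg hx.le p
  contDiffOn x hx := (Real.contDiffAt_rpow_const_of_ne hx.ne').contDiffWithinAt
  deriv_isBigO := by
    refine ⟨max p 1, ⟨le_max_right p 1, max_lt hpq hq⟩, Asymptotics.IsBigO.of_bound |p| ?_⟩
    filter_upwards [eventually_ge_atTop 1] with x hx
    have hx0 : 0 < x := one_pos.trans_le hx
    rw [Real.deriv_rpow_const, norm_mul, Real.norm_of_nonneg (Real.rpow_nonneg hx0.le _),
      Real.norm_of_nonneg (Real.rpow_nonneg hx0.le _), Real.norm_eq_abs]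
    gcongr
    exact le_max_left p 1

theorem isLowerOrder_zero {q : ℝ} (hq : 1 < q) : IsLowerOrder q fun _ => 0 where
  nonneg _ _ := le_rfl
  contDiffOn := contDiffOn_const
  deriv_isBigO := ⟨1, ⟨le_rfl, hq⟩, by
    rw [deriv_const']
    exact Asymptotics.isBigO_zero _ _⟩

theorem emdenFowlerSource_add_rpow {θ q x : ℝ} (hθ : θ * (q - 1) = 2) (φ : ℝ → ℝ) (hx : 0 ≤ x)
    (t : ℝ) : emdenFowlerSource θ (fun u => φ u + u ^ q) t x =
      emdenFowlerSource θ φ t x + x ^ q := by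
  rw [← emdenFowlerSource_rpow hθ hx t]
  exact mul_add _ _ _

theorem continuousOn_emdenFowlerSource {f : ℝ → ℝ} (hf : ContinuousOn f (Ioi 0)) (θ : ℝ) :
    ContinuousOn (Function.uncurry (emdenFowlerSource θ f)) (univ ×ˢ Ioi 0) :=
  ContinuousOn.mul (by fun_prop)
    (hf.comp (by fun_prop) fun _ hz => mul_pos (Real.exp_pos _) hz.2)

theorem hasDerivAt_emdenFowlerSource {θ t x : ℝ} {φ : ℝ → ℝ}
    (hφ : DifferentiableAt ℝ φ (Real.exp (-θ * t) * x)) :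
    HasDerivAt (emdenFowlerSource θ φ t)
      (Real.exp (2 * t) * deriv φ (Real.exp (-θ * t) * x)) x := by
  refine ((hφ.hasDerivAt.comp x (hasDerivAt_const_mul (Real.exp (-θ * t)))).const_mul
    (Real.exp ((θ + 2) * t))).congr_deriv ?_
  have hexp : Real.exp (2 * t) = Real.exp ((θ + 2) * t) * Real.exp (-θ * t) := by
    rw [← Real.exp_add]
    ring_nf
  rw [hexp]
  ring

namespace IsLowerOrder

variable {q : ℝ} {φ : ℝ → ℝ}

theorem rpow_le_add (hφ : IsLowerOrder q φ) (x : ℝ) (hx : 0 < x) : x ^ q ≤ φ x + x ^ q :=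
  le_add_of_nonneg_left (hφ.nonneg x hx)

theorem differentiableAt (hφ : IsLowerOrder q φ) {x : ℝ} (hx : 0 < x) : DifferentiableAt ℝ φ x :=
  (hφ.contDiffOn.differentiableOn one_ne_zero).differentiableAt (Ioi_mem_nhds hx)

theorem contDiffOn_add_rpow (hφ : IsLowerOrder q φ) :
    ContDiffOn ℝ 1 (fun u => φ u + u ^ q) (Ioi 0) :=
  hφ.contDiffOn.add fun _ hx => (Real.contDiffAt_rpow_const_of_ne hx.ne').contDiffWithinAt

theorem exists_source_isBigO (hφ : IsLowerOrder q φ) {θ : ℝ} (hθ : 0 < θ)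
    (hscaling : θ * (q - 1) = 2) : ∃ δ > 0, ∀ v : ℝ → ℝ, (∀ᶠ t in atBot, 0 < v t) →
      v =O[atBot] (fun _ => (1 : ℝ)) → Tendsto (fun t => Real.exp (-θ * t) * v t) atBot atTop →
      (fun t => emdenFowlerSource θ φ t (v t)) =O[atBot] fun t => Real.exp (δ * t) * v t := by
  obtain ⟨s, ⟨hs1, hsq⟩, hderiv⟩ := hφ.deriv_isBigO
  have hO : φ =O[atTop] fun x => x ^ s := isBigO_rpow_of_deriv_isBigO_rpow hs1
    ((eventually_gt_atTop 0).mono fun x hx => hφ.differentiableAt hx) hderiv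
  refine ⟨θ * (q - s), mul_pos hθ (sub_pos.2 hsq), fun v hpos hv hsing => ?_⟩
  have hpow : (fun t => v t ^ (s - 1)) =O[atBot] (fun _ => (1 : ℝ)) := by
    simpa using hv.rpow (sub_nonneg.2 hs1) (Eventually.of_forall fun _ => zero_le_one)
  have hmain : (fun t => emdenFowlerSource θ φ t (v t)) =O[atBot]
      fun t => Real.exp ((θ + 2) * t) * (Real.exp (-θ * t) * v t) ^ s :=
    (Asymptotics.isBigO_refl _ _).mul (hO.comp_tendsto hsing)
  refine hmain.trans ?_
  have hprod : (fun t => Real.exp (θ * (q - s) * t) * v t * v t ^ (s - 1)) =O[atBot]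
      fun t => Real.exp (θ * (q - s) * t) * v t := by
    simpa using (Asymptotics.isBigO_refl (fun t => Real.exp (θ * (q - s) * t) * v t) atBot).mul hpow
  refine hprod.congr' ?_ EventuallyEq.rfl
  filter_upwards [hpos] with t ht
  have hexp : θ * (q - s) * t = (θ + 2) * t + -θ * t * s := by linear_combination t * hscaling
  have hv_pow : v t * v t ^ (s - 1) = v t ^ s := by
    rw [mul_comm, ← Real.rpow_add_one ht.ne', sub_add_cancel]
  rw [mul_assoc, hv_pow, Real.mul_rpow (Real.exp_pos _).le ht.le, ← Real.exp_mul, hexp,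
    Real.exp_add, mul_assoc]

theorem eventually_abs_deriv_source_le (hφ : IsLowerOrder q φ) {θ : ℝ} (hθ : 0 < θ)
    (hscaling : θ * (q - 1) = 2) {m M ε : ℝ} (hm : 0 < m) (hε : 0 < ε) :
    ∀ᶠ t in atBot, ∀ x ∈ Icc m M,
      |Real.exp (2 * t) * deriv φ (Real.exp (-θ * t) * x)| ≤ ε := by
  obtain ⟨s, ⟨hs1, hsq⟩, hderiv⟩ := hφ.deriv_isBigO
  obtain ⟨C, hC, hbound⟩ := hderiv.exists_nonneg
  obtain ⟨X, hX⟩ := eventually_atTop.1 hbound.bound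
  have hlarge : Tendsto (fun t : ℝ => Real.exp (-θ * t) * m) atBot atTop :=
    tendsto_exp_neg_mul_mul_const hθ hm
  have hsmall : Tendsto (fun t => C * M ^ (s - 1) * Real.exp (θ * (q - s) * t)) atBot (𝓝 0) := by
    simpa using (tendsto_exp_mul_atBot (mul_pos hθ (sub_pos.2 hsq))).const_mul (C * M ^ (s - 1))
  filter_upwards [hlarge.eventually_ge_atTop X, hsmall.eventually_le_const hε] with t hXt hεt x hx
  have hx0 : 0 < x := hm.trans_le hx.1
  have hy0 : 0 < Real.exp (-θ * t) * x := mul_pos (Real.exp_pos _) hx0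
  have hderiv_le := hX (Real.exp (-θ * t) * x)
    (hXt.trans (mul_le_mul_of_nonneg_left hx.1 (Real.exp_pos _).le))
  rw [Real.norm_of_nonneg (Real.rpow_nonneg hy0.le _)] at hderiv_le
  have hexp : θ * (q - s) * t = 2 * t + -θ * t * (s - 1) := by linear_combination t * hscaling
  calc |Real.exp (2 * t) * deriv φ (Real.exp (-θ * t) * x)|
      ≤ Real.exp (2 * t) * (C * (Real.exp (-θ * t) * x) ^ (s - 1)) := by
        rw [abs_mul, Real.abs_exp]
        exact mul_le_mul_of_nonneg_left hderiv_le (Real.exp_pos _).le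
    _ = C * x ^ (s - 1) * Real.exp (θ * (q - s) * t) := by
        rw [Real.mul_rpow (Real.exp_pos _).le hx0.le, ← Real.exp_mul, hexp, Real.exp_add]
        ring
    _ ≤ C * M ^ (s - 1) * Real.exp (θ * (q - s) * t) := by
        have := Real.rpow_le_rpow hx0.le hx.2 (sub_nonneg.2 hs1)
        gcongr
    _ ≤ ε := hεt

theorem eventually_abs_source_sub_le (hφ : IsLowerOrder q φ) {θ : ℝ} (hθ : 0 < θ)
    (hscaling : θ * (q - 1) = 2) {m M ε : ℝ} (hm : 0 < m) (hε : 0 < ε) :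
    ∀ᶠ t in atBot, ∀ x ∈ Icc m M, ∀ y ∈ Icc m M,
      |emdenFowlerSource θ φ t x - emdenFowlerSource θ φ t y| ≤ ε * |x - y| := by
  filter_upwards [hφ.eventually_abs_deriv_source_le hθ hscaling hm hε] with t ht x hx y hy
  exact (convex_Icc m M).norm_image_sub_le_of_norm_hasDerivWithin_le
    (fun z hz => (hasDerivAt_emdenFowlerSource (hφ.differentiableAt
      (mul_pos (Real.exp_pos _) (hm.trans_le hz.1)))).hasDerivWithinAt) ht hy hx

end IsLowerOrder

/-! ### Convergence to the equilibrium -/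

/-- The positive equilibrium of the autonomous equation `v'' + (β - θ) v' - θ β v + v ^ q = 0`. -/
noncomputable def emdenFowlerEquilibrium (θ β q : ℝ) : ℝ :=
  (θ * β) ^ (1 / (q - 1))

section Equilibrium

variable {θ β q : ℝ}

theorem emdenFowlerEquilibrium_pos (hs : IsSupercritical θ β q) :
    0 < emdenFowlerEquilibrium θ β q :=
  Real.rpow_pos_of_pos (mul_pos hs.theta_pos hs.beta_pos) _

theorem emdenFowlerEquilibrium_rpow_sub_one (hs : IsSupercritical θ β q) :
    emdenFowlerEquilibrium θ β q ^ (q - 1) = θ * β := by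
  rw [emdenFowlerEquilibrium, ← Real.rpow_mul (mul_pos hs.theta_pos hs.beta_pos).le,
    one_div_mul_cancel (sub_pos.2 hs.one_lt).ne', Real.rpow_one]

theorem emdenFowlerEquilibrium_rpow (hs : IsSupercritical θ β q) :
    emdenFowlerEquilibrium θ β q ^ q = θ * β * emdenFowlerEquilibrium θ β q := by
  rw [← emdenFowlerEquilibrium_rpow_sub_one hs,
    ← Real.rpow_add_one (emdenFowlerEquilibrium_pos hs).ne', sub_add_cancel]

end Equilibrium

namespace IsEmdenFowlerSolution

variable {θ β q T : ℝ} {φ v w : ℝ → ℝ}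

theorem hasDerivAt_snd_add_rpow (hs : IsSupercritical θ β q)
    (h : IsEmdenFowlerSolution θ β (fun u => φ u + u ^ q) T v w) {t : ℝ} (ht : t < T) :
    HasDerivAt w (θ * β * v t - v t ^ q - (β - θ) * w t - emdenFowlerSource θ φ t (v t)) t := by
  refine (h.hasDerivAt_snd t ht).congr_deriv ?_
  rw [emdenFowlerSource_add_rpow hs.scaling φ (h.pos t ht).le]
  ring

theorem exists_source_isBigO (hs : IsSupercritical θ β q) (hφ : IsLowerOrder q φ)
    (h : IsEmdenFowlerSolution θ β (fun u => φ u + u ^ q) T v w) :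
    ∃ δ > 0, (fun t => emdenFowlerSource θ φ t (v t)) =O[atBot]
      fun t => Real.exp (δ * t) * v t := by
  obtain ⟨δ, hδ, hO⟩ := hφ.exists_source_isBigO hs.theta_pos hs.scaling
  exact ⟨δ, hδ, hO v h.eventually_pos (h.isBigO_fst hs hφ.rpow_le_add) h.singular⟩

theorem tendsto_source (hs : IsSupercritical θ β q) (hφ : IsLowerOrder q φ)
    (h : IsEmdenFowlerSolution θ β (fun u => φ u + u ^ q) T v w) :
    Tendsto (fun t => emdenFowlerSource θ φ t (v t)) atBot (𝓝 0) := by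
  obtain ⟨δ, hδ, hO⟩ := h.exists_source_isBigO hs hφ
  exact hO.trans_tendsto (tendsto_exp_mul_mul_atBot hδ (h.isBigO_fst hs hφ.rpow_le_add))

theorem isBigO_fst_rpow (hs : IsSupercritical θ β q) (hφ : IsLowerOrder q φ)
    (h : IsEmdenFowlerSolution θ β (fun u => φ u + u ^ q) T v w) {r : ℝ} (hr : 0 ≤ r) :
    (fun t => v t ^ r) =O[atBot] fun _ => (1 : ℝ) := by
  simpa using (h.isBigO_fst hs hφ.rpow_le_add).rpow hr (Eventually.of_forall fun _ => zero_le_one)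

theorem isBigO_snd_deriv (hs : IsSupercritical θ β q) (hφ : IsLowerOrder q φ)
    (h : IsEmdenFowlerSolution θ β (fun u => φ u + u ^ q) T v w) :
    (fun t => θ * β * v t - v t ^ q - (β - θ) * w t - emdenFowlerSource θ φ t (v t)) =O[atBot]
      fun _ => (1 : ℝ) := by
  have hv := h.isBigO_fst hs hφ.rpow_le_add
  have hw := h.isBigO_snd hs hφ.rpow_le_add
  have hvq := h.isBigO_fst_rpow hs hφ (r := q) (by linarith [hs.one_lt])
  exact (((hv.const_mul_left _).sub hvq).sub (hw.const_mul_left _)).sub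
    ((h.tendsto_source hs hφ).isBigO_one ℝ)

theorem hasDerivAt_energy (hs : IsSupercritical θ β q)
    (h : IsEmdenFowlerSolution θ β (fun u => φ u + u ^ q) T v w) {t : ℝ} (ht : t < T) :
    HasDerivAt (fun s => w s ^ 2 / 2 - θ * β * (v s ^ 2 / 2) + v s ^ (q + 1) / (q + 1))
      (-(β - θ) * w t ^ 2 + -(emdenFowlerSource θ φ t (v t) * w t)) t := by
  have hv' := h.hasDerivAt_fst t ht
  refine (((((h.hasDerivAt_snd_add_rpow hs ht).pow 2).div_const 2).sub
    (((hv'.pow 2).div_const 2).const_mul (θ * β))).add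
    ((hv'.rpow_const (p := q + 1) (Or.inl (h.pos t ht).ne')).div_const (q + 1))).congr_deriv ?_
  have hq : q + 1 ≠ 0 := by linarith [hs.one_lt]
  rw [add_sub_cancel_right]
  field_simp
  push_cast
  ring

theorem exists_tendsto_energy (hs : IsSupercritical θ β q) (hφ : IsLowerOrder q φ)
    (h : IsEmdenFowlerSolution θ β (fun u => φ u + u ^ q) T v w) :
    ∃ l, Tendsto (fun t => w t ^ 2 / 2 - θ * β * (v t ^ 2 / 2) + v t ^ (q + 1) / (q + 1))
      atBot (𝓝 l) := by
  have hv := h.isBigO_fst hs hφ.rpow_le_add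
  have hw := h.isBigO_snd hs hφ.rpow_le_add
  have hq : 0 ≤ q + 1 := by linarith [hs.one_lt]
  obtain ⟨δ, hδ, hO⟩ := h.exists_source_isBigO hs hφ
  have hwork : (fun t => emdenFowlerSource θ φ t (v t) * w t) =O[atBot]
      fun t => Real.exp (δ * t) := by
    simpa using (hO.trans (by simpa using (Asymptotics.isBigO_refl _ _).mul hv)).mul hw
  obtain ⟨C, hC⟩ := hwork.bound
  refine exists_tendsto_atBot_of_hasDerivAt_le_exp (C := C) hδ
    ((eventually_lt_atBot T).mono fun t ht => h.hasDerivAt_energy hs ht) ?_ ?_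
  · filter_upwards [hC] with t ht
    rw [Real.norm_eq_abs, Real.norm_of_nonneg (Real.exp_pos _).le] at ht
    have hdamping : 0 ≤ (β - θ) * w t ^ 2 :=
      mul_nonneg (sub_nonneg.2 hs.theta_lt.le) (sq_nonneg _)
    linarith [neg_le_abs (emdenFowlerSource θ φ t (v t) * w t)]
  · have hv2 : (fun t => v t ^ 2) =O[atBot] fun _ => (1 : ℝ) := by simpa using hv.pow 2
    have hw2 : (fun t => w t ^ 2) =O[atBot] fun _ => (1 : ℝ) := by simpa using hw.pow 2
    simp only [div_eq_inv_mul]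
    exact ((hw2.const_mul_left _).sub ((hv2.const_mul_left _).const_mul_left _)).add
      ((h.isBigO_fst_rpow hs hφ hq).const_mul_left _)

theorem tendsto_snd (hs : IsSupercritical θ β q) (hφ : IsLowerOrder q φ)
    (h : IsEmdenFowlerSolution θ β (fun u => φ u + u ^ q) T v w) : Tendsto w atBot (𝓝 0) := by
  have hw := h.isBigO_snd hs hφ.rpow_le_add
  obtain ⟨l, hl⟩ := h.exists_tendsto_energy hs hφ
  have hwork : Tendsto (fun t => -(emdenFowlerSource θ φ t (v t) * w t)) atBot (𝓝 0) := by
    have hO := ((Asymptotics.isBigO_refl (fun t => emdenFowlerSource θ φ t (v t)) atBot).mul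
      hw).neg_left
    exact hO.trans_tendsto (by simpa using h.tendsto_source hs hφ)
  have hdamping : Tendsto (fun t => -(β - θ) * w t ^ 2) atBot (𝓝 0) := by
    refine tendsto_zero_of_tendsto_of_hasDerivAt_add
      ((eventually_lt_atBot T).mono fun t ht => h.hasDerivAt_energy hs ht) hl hwork
      ((eventually_lt_atBot T).mono fun t ht =>
        ((h.hasDerivAt_snd_add_rpow hs ht).pow 2).const_mul (-(β - θ))) ?_
    simpa using (((hw.const_mul_left 2).mul (h.isBigO_snd_deriv hs hφ))).const_mul_left (-(β - θ))
  have hsq : Tendsto (fun t => w t ^ 2) atBot (𝓝 0) := by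
    have hα : -(β - θ) ≠ 0 := by linarith [hs.theta_lt]
    simpa only [inv_mul_cancel_left₀ hα, mul_zero] using hdamping.const_mul (-(β - θ))⁻¹
  have habs : Tendsto (fun t => |w t|) atBot (𝓝 0) := by
    simpa only [Real.sqrt_sq_eq_abs, Real.sqrt_zero] using hsq.sqrt
  exact (tendsto_zero_iff_abs_tendsto_zero w).2 habs

theorem tendsto_balance (hs : IsSupercritical θ β q) (hφ : IsLowerOrder q φ)
    (h : IsEmdenFowlerSolution θ β (fun u => φ u + u ^ q) T v w) :
    Tendsto (fun t => θ * β * v t - v t ^ q) atBot (𝓝 0) := by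
  have hw := h.isBigO_snd hs hφ.rpow_le_add
  have herror : Tendsto (fun t => -(β - θ) * w t - emdenFowlerSource θ φ t (v t)) atBot (𝓝 0) := by
    simpa using ((h.tendsto_snd hs hφ).const_mul (-(β - θ))).sub (h.tendsto_source hs hφ)
  refine tendsto_zero_of_tendsto_of_hasDerivAt_add ?_ (h.tendsto_snd hs hφ) herror
    ((eventually_lt_atBot T).mono fun t ht => ((h.hasDerivAt_fst t ht).const_mul (θ * β)).sub
      ((h.hasDerivAt_fst t ht).rpow_const (Or.inl (h.pos t ht).ne'))) ?_
  · filter_upwards [eventually_lt_atBot T] with t ht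
    refine (h.hasDerivAt_snd_add_rpow hs ht).congr_deriv ?_
    ring
  · have hpow := h.isBigO_fst_rpow hs hφ (r := q - 1) (sub_nonneg.2 hs.one_lt.le)
    have hpow_deriv : (fun t => w t * q * v t ^ (q - 1)) =O[atBot] fun _ => (1 : ℝ) := by
      simpa [mul_comm] using (hw.const_mul_left q).mul hpow
    exact (hw.const_mul_left (θ * β)).sub hpow_deriv

theorem isBigO_fst_exp_of_tendsto_zero (hs : IsSupercritical θ β q) (hφ : IsLowerOrder q φ)
    (h : IsEmdenFowlerSolution θ β (fun u => φ u + u ^ q) T v w) (hv0 : Tendsto v atBot (𝓝 0))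
    {a : ℝ} (ha : 0 < a) (haβ : a < β) : v =O[atBot] fun t => Real.exp ((θ - a) * t) := by
  have hq : 0 < q - 1 := sub_pos.2 hs.one_lt
  obtain ⟨δ, hδ, hO⟩ := h.exists_source_isBigO hs hφ
  obtain ⟨C, hC⟩ := hO.bound
  have hcoeff : Tendsto (fun t => C * Real.exp (δ * t) + v t ^ (q - 1)) atBot (𝓝 0) := by
    simpa [Real.zero_rpow hq.ne'] using ((tendsto_exp_mul_atBot hδ).const_mul C).add
      (hv0.rpow_const (p := q - 1) (Or.inr hq.le))
  have hpos : 0 < a * (β - a + θ) := mul_pos ha (by linarith [hs.theta_pos])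
  refine h.isBigO_exp_of_source_le haβ (h.isBigO_fst hs hφ.rpow_le_add)
    (h.isBigO_snd hs hφ.rpow_le_add) ?_
  filter_upwards [hC, hcoeff.eventually_le_const hpos, h.eventually_pos] with t hCt hcoeff_t hvt
  have hsource := (le_abs_self _).trans hCt
  rw [Real.norm_of_nonneg (mul_pos (Real.exp_pos _) hvt).le] at hsource
  have hpow : v t ^ q = v t ^ (q - 1) * v t := by
    rw [← Real.rpow_add_one hvt.ne', sub_add_cancel]
  rw [emdenFowlerSource_add_rpow hs.scaling φ hvt.le, hpow]
  linarith [mul_le_mul_of_nonneg_right hcoeff_t hvt.le]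

theorem not_tendsto_zero (hs : IsSupercritical θ β q) (hφ : IsLowerOrder q φ)
    (h : IsEmdenFowlerSolution θ β (fun u => φ u + u ^ q) T v w) : ¬ Tendsto v atBot (𝓝 0) := by
  intro hv0
  have hθ := hs.theta_pos
  have hq : 0 < q := one_pos.trans hs.one_lt
  obtain ⟨δ, hδ, hO⟩ := h.exists_source_isBigO hs hφ
  obtain ⟨a, ha, haθ, haδ, haq⟩ : ∃ a > 0, a ≤ θ ∧ 2 * a ≤ δ ∧ a * q ≤ 1 := by
    refine ⟨min θ (min (δ / 2) (1 / q)), by positivity, min_le_left _ _, ?_, ?_⟩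
    · linarith [(min_le_right θ _).trans (min_le_left (δ / 2) (1 / q))]
    · exact (le_div_iff₀ hq).1 ((min_le_right θ _).trans (min_le_right (δ / 2) (1 / q)))
  have hdecay : v =O[atBot] fun t => Real.exp ((θ - a) * t) :=
    h.isBigO_fst_exp_of_tendsto_zero hs hφ hv0 ha (haθ.trans_lt hs.theta_lt)
  have hlower : (fun t => emdenFowlerSource θ φ t (v t)) =O[atBot]
      fun t => Real.exp ((θ + min 1 (δ / 2)) * t) := by
    refine (hO.trans ((Asymptotics.isBigO_refl _ _).mul hdecay)).trans ?_
    simp only [← Real.exp_add, ← add_mul]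
    exact isBigO_exp_mul_atBot (by linarith [min_le_right 1 (δ / 2)])
  have hpower : (fun t => v t ^ q) =O[atBot] fun t => Real.exp ((θ + min 1 (δ / 2)) * t) := by
    refine (hdecay.rpow hq.le (Eventually.of_forall fun t => (Real.exp_pos _).le)).trans ?_
    simp only [← Real.exp_mul, mul_right_comm _ _ q]
    exact isBigO_exp_mul_atBot (by nlinarith [min_le_left 1 (δ / 2), hs.scaling])
  refine h.not_source_isBigO_exp (c := min 1 (δ / 2)) hs.beta_pos hθ.le (by positivity)
    (h.isBigO_fst hs hφ.rpow_le_add) (h.isBigO_snd hs hφ.rpow_le_add)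
    ((hlower.add hpower).congr' ?_ EventuallyEq.rfl)
  filter_upwards [h.eventually_pos] with t ht
  exact (emdenFowlerSource_add_rpow hs.scaling φ ht.le t).symm

theorem tendsto_equilibrium (hs : IsSupercritical θ β q) (hφ : IsLowerOrder q φ)
    (h : IsEmdenFowlerSolution θ β (fun u => φ u + u ^ q) T v w) :
    Tendsto v atBot (𝓝 (emdenFowlerEquilibrium θ β q)) := by
  refine (tendsto_zero_or_tendsto_rpow_of_balance (mul_pos hs.theta_pos hs.beta_pos)
    (sub_pos.2 hs.one_lt) h.eventually_pos ((eventually_lt_atBot T).mono fun t ht =>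
      (h.hasDerivAt_fst t ht).continuousAt) ?_).resolve_left (h.not_tendsto_zero hs hφ)
  refine (h.tendsto_balance hs hφ).congr' ?_
  filter_upwards [h.eventually_pos] with t ht
  rw [mul_sub, mul_comm (v t) (v t ^ (q - 1)), ← Real.rpow_add_one ht.ne', sub_add_cancel,
    mul_comm (v t)]

end IsEmdenFowlerSolution

/-! ### Uniqueness -/

theorem IsLowerOrder.exists_eventually_abs_source_sub_sub_le {θ q x₀ ε : ℝ} {φ : ℝ → ℝ}
    (hφ : IsLowerOrder q φ) (hθ : 0 < θ) (hscaling : θ * (q - 1) = 2) (hx₀ : 0 < x₀) (hε : 0 < ε) :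
    ∃ r ∈ Ioo 0 x₀, ∀ᶠ t in atBot, ∀ x ∈ Icc (x₀ - r) (x₀ + r), ∀ y ∈ Icc (x₀ - r) (x₀ + r),
      |emdenFowlerSource θ (fun u => φ u + u ^ q) t x -
        emdenFowlerSource θ (fun u => φ u + u ^ q) t y - q * x₀ ^ (q - 1) * (x - y)| ≤
        ε * |x - y| := by
  have hstrict : ∀ᶠ z : ℝ × ℝ in 𝓝 (x₀, x₀),
      |z.1 ^ q - z.2 ^ q - q * x₀ ^ (q - 1) * (z.1 - z.2)| ≤ ε / 2 * |z.1 - z.2| := by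
    filter_upwards [(Real.hasStrictDerivAt_rpow_const (p := q)
      (Or.inl hx₀.ne')).hasStrictFDerivAt.isLittleO.def (half_pos hε)] with z hz
    simpa [mul_comm] using hz
  obtain ⟨r, ⟨hr, hrx₀⟩, hball⟩ : ∃ r ∈ Ioo 0 x₀, ∀ x ∈ Icc (x₀ - r) (x₀ + r),
      ∀ y ∈ Icc (x₀ - r) (x₀ + r),
        |x ^ q - y ^ q - q * x₀ ^ (q - 1) * (x - y)| ≤ ε / 2 * |x - y| := by
    obtain ⟨r, hr, hsub⟩ := Metric.nhds_basis_closedBall.eventually_iff.1 hstrict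
    refine ⟨min r (x₀ / 2), ⟨by positivity, by linarith [min_le_right r (x₀ / 2)]⟩,
      fun x hx y hy => hsub (x := (x, y)) ?_⟩
    rw [← closedBall_prod_same, mem_prod, Real.closedBall_eq_Icc]
    have hIcc : Icc (x₀ - min r (x₀ / 2)) (x₀ + min r (x₀ / 2)) ⊆ Icc (x₀ - r) (x₀ + r) :=
      Icc_subset_Icc (by linarith [min_le_left r (x₀ / 2)]) (by linarith [min_le_left r (x₀ / 2)])
    exact ⟨hIcc hx, hIcc hy⟩
  refine ⟨r, ⟨hr, hrx₀⟩, ?_⟩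
  filter_upwards [hφ.eventually_abs_source_sub_le hθ hscaling (M := x₀ + r) (sub_pos.2 hrx₀)
    (half_pos hε)] with t ht x hx y hy
  rw [emdenFowlerSource_add_rpow hscaling φ ((sub_pos.2 hrx₀).le.trans hx.1),
    emdenFowlerSource_add_rpow hscaling φ ((sub_pos.2 hrx₀).le.trans hy.1)]
  calc _ = |(emdenFowlerSource θ φ t x - emdenFowlerSource θ φ t y) +
          (x ^ q - y ^ q - q * x₀ ^ (q - 1) * (x - y))| := by ring_nf
    _ ≤ ε / 2 * |x - y| + ε / 2 * |x - y| :=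
        (abs_add_le _ _).trans (add_le_add (ht x hx y hy) (hball x hx y hy))
    _ = ε * |x - y| := by ring

/-- The dissipation of `e ^ 2 / 2 + κ * d ^ 2 / 2 + μ * d * e` along `d' = e`,
`e' = -κ * d - α * e - ρ`. -/
theorem lyapunov_dissipation_nonneg {α κ μ η d e ρ : ℝ} (hα : 0 < α) (hκ : 0 < κ) (hμ : 0 < μ)
    (hη : 0 < η) (hμκ : 4 * α * μ ≤ κ) (hμα : 4 * μ ≤ α) (hηα : 2 * η ≤ α)
    (hημ : 2 * η ≤ μ * κ) (hηκ : 4 * η ≤ κ) (hρ : |ρ| ≤ η * |d|) :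
    0 ≤ α * e ^ 2 + e * ρ - μ * e ^ 2 + μ * κ * d ^ 2 + μ * α * (d * e) + μ * (d * ρ) := by
  have heρ : -(η * ((e ^ 2 + d ^ 2) / 2)) ≤ e * ρ := by
    have habs : |e * ρ| ≤ |e| * (η * |d|) := by rw [abs_mul]; gcongr
    have hyoung := mul_le_mul_of_nonneg_left (two_mul_le_add_sq |e| |d|) hη.le
    rw [sq_abs, sq_abs] at hyoung
    linarith [neg_abs_le (e * ρ)]
  have hdρ : -(μ * (η * d ^ 2)) ≤ μ * (d * ρ) := by
    have habs : |d * ρ| ≤ |d| * (η * |d|) := by rw [abs_mul]; gcongr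
    have hsq : |d| * (η * |d|) = η * d ^ 2 := by rw [← sq_abs d]; ring
    rw [← mul_neg]
    exact mul_le_mul_of_nonneg_left (by linarith [neg_abs_le (d * ρ)]) hμ.le
  have hde : -(μ * κ / 4 * d ^ 2 + α / 4 * e ^ 2) ≤ μ * α * (d * e) := by
    have hsquare : 0 ≤ μ * (κ * d + 2 * α * e) ^ 2 := by positivity
    have he_le : 4 * α * μ * (α * e ^ 2) ≤ κ * (α * e ^ 2) := by gcongr
    have hscaled : 0 ≤ κ * (4 * (μ * α * (d * e)) + (μ * κ * d ^ 2 + α * e ^ 2)) := by linarith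
    linarith [nonneg_of_mul_nonneg_right hscaled hκ]
  have he_coeff : 0 ≤ e ^ 2 * (α - η / 2 - μ - α / 4) := mul_nonneg (sq_nonneg _) (by linarith)
  have hd_coeff : 0 ≤ d ^ 2 * (3 * (μ * κ) / 4 - η / 2 - μ * η) :=
    mul_nonneg (sq_nonneg _) (by linarith [mul_le_mul_of_nonneg_left hηκ hμ.le])
  linarith

theorem exists_lyapunov_constant {α κ : ℝ} (hα : 0 < α) (hκ : 0 < κ) :
    ∃ μ > 0, 4 * α * μ ≤ κ ∧ 4 * μ ≤ α ∧ 4 * μ ^ 2 ≤ κ := by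
  refine ⟨min (κ / (4 * α)) (min (α / 4) (√κ / 2)), by positivity, ?_, ?_, ?_⟩
  · exact (le_div_iff₀' (by positivity)).1 (min_le_left _ _)
  · linarith [(min_le_right (κ / (4 * α)) _).trans (min_le_left (α / 4) (√κ / 2))]
  · have hsq := pow_le_pow_left₀ (by positivity)
      ((min_le_right (κ / (4 * α)) _).trans (min_le_right (α / 4) (√κ / 2))) 2
    rw [div_pow, Real.sq_sqrt hκ.le] at hsq
    linarith

theorem eq_zero_of_sq_add_mul_nonpos {κ μ d e : ℝ} (hκ : 0 < κ) (hμ : 4 * μ ^ 2 ≤ κ)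
    (h : e ^ 2 / 2 + κ * (d ^ 2 / 2) + μ * (d * e) ≤ 0) : d = 0 ∧ e = 0 := by
  have hsquare : 0 ≤ (e + 2 * μ * d) ^ 2 := sq_nonneg _
  have hμd : 4 * μ ^ 2 * d ^ 2 ≤ κ * d ^ 2 := by gcongr
  have hκd : 0 ≤ κ * d ^ 2 := by positivity
  have hd : κ * d ^ 2 = 0 := by linarith [sq_nonneg e]
  have he : e ^ 2 = 0 := by linarith [sq_nonneg e]
  exact ⟨by simpa [hκ.ne'] using hd, by simpa using he⟩

theorem eventually_eq_zero_of_damped_oscillator {α κ : ℝ} {d e ρ : ℝ → ℝ} (hα : 0 < α)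
    (hκ : 0 < κ) (hd : ∀ᶠ t in atBot, HasDerivAt d (e t) t)
    (he : ∀ᶠ t in atBot, HasDerivAt e (-κ * d t - α * e t - ρ t) t) (hρ : ρ =o[atBot] d)
    (hd0 : Tendsto d atBot (𝓝 0)) (he0 : Tendsto e atBot (𝓝 0)) :
    ∀ᶠ t in atBot, d t = 0 ∧ e t = 0 := by
  obtain ⟨μ, hμ, hμκ, hμα, hμsq⟩ := exists_lyapunov_constant hα hκ
  obtain ⟨η, hη, hηα, hημ, hηκ⟩ : ∃ η > 0, 2 * η ≤ α ∧ 2 * η ≤ μ * κ ∧ 4 * η ≤ κ := by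
    refine ⟨min (α / 2) (min (μ * κ / 2) (κ / 4)), by positivity, ?_, ?_, ?_⟩
    · linarith [min_le_left (α / 2) (min (μ * κ / 2) (κ / 4))]
    · linarith [(min_le_right (α / 2) _).trans (min_le_left (μ * κ / 2) (κ / 4))]
    · linarith [(min_le_right (α / 2) _).trans (min_le_right (μ * κ / 2) (κ / 4))]
  obtain ⟨N, hN⟩ := eventually_atBot.1 ((hd.and he).and (hρ.def hη))
  have hV0 : Tendsto (fun t => -(e t ^ 2 / 2 + κ * (d t ^ 2 / 2) + μ * (d t * e t))) atBot
      (𝓝 0) := by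
    simpa using ((((he0.pow 2).div_const 2).add (((hd0.pow 2).div_const 2).const_mul κ)).add
      ((hd0.mul he0).const_mul μ)).neg
  have hV' : ∀ t ≤ N, HasDerivAt (fun t => -(e t ^ 2 / 2 + κ * (d t ^ 2 / 2) + μ * (d t * e t)))
      (α * e t ^ 2 + e t * ρ t - μ * e t ^ 2 +
      μ * κ * d t ^ 2 + μ * α * (d t * e t) + μ * (d t * ρ t)) t := fun t ht => by
    obtain ⟨⟨hdt, het⟩, -⟩ := hN t ht
    refine ((((het.pow 2).div_const 2).add (((hdt.pow 2).div_const 2).const_mul κ)).add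
      ((hdt.mul het).const_mul μ)).neg.congr_deriv ?_
    push_cast
    ring
  filter_upwards [eventually_le_atBot N] with t ht
  have hV_le := nonneg_of_hasDerivAt_nonneg_of_eventually_ge
    (fun s hs => hV' s (hs.trans ht)) (fun s hs => lyapunov_dissipation_nonneg hα hκ hμ hη hμκ hμα
      hηα hημ hηκ (hN s (hs.trans ht)).2) hV0 (Eventually.of_forall fun _ => le_rfl)
  exact eq_zero_of_sq_add_mul_nonpos hκ hμsq (neg_nonneg.1 hV_le)

theorem eq_zero_of_abs_second_deriv_le {a b A B : ℝ} {d e e' : ℝ → ℝ}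
    (hd : ∀ t ∈ Icc a b, HasDerivAt d (e t) t) (he : ∀ t ∈ Icc a b, HasDerivAt e (e' t) t)
    (hle : ∀ t ∈ Icc a b, |e' t| ≤ A * |d t| + B * |e t|) (hda : d a = 0) (hea : e a = 0) {t : ℝ}
    (ht : t ∈ Icc a b) : d t = 0 := by
  have hderiv : ∀ s ∈ Icc a b, HasDerivAt (fun s => (d s, e s)) (e s, e' s) s :=
    fun s hs => (hd s hs).prodMk (he s hs)
  refine congrArg Prod.fst (eq_zero_of_abs_deriv_le_mul_abs_self_of_eq_zero_right
    (K := 1 + |A| + |B|) (fun s hs => (hderiv s hs).continuousAt.continuousWithinAt)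
    (fun s hs => (hderiv s (Ico_subset_Icc_self hs)).hasDerivWithinAt)
    (Prod.ext hda hea) (fun s hs => ?_) t ht)
  have hd_le : |d s| ≤ ‖(d s, e s)‖ := norm_fst_le (d s, e s)
  have he_le : |e s| ≤ ‖(d s, e s)‖ := norm_snd_le (d s, e s)
  have hA : A * |d s| ≤ |A| * ‖(d s, e s)‖ := by gcongr; exact le_abs_self A
  have hB : B * |e s| ≤ |B| * ‖(d s, e s)‖ := by gcongr; exact le_abs_self B
  refine norm_prod_le_iff.2 ⟨?_, ?_⟩
  · exact he_le.trans
      (le_mul_of_one_le_left (norm_nonneg _) (by linarith [abs_nonneg A, abs_nonneg B]))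
  · calc |e' s| ≤ A * |d s| + B * |e s| := hle s (Ico_subset_Icc_self hs)
      _ ≤ (1 + |A| + |B|) * ‖(d s, e s)‖ := by linarith [norm_nonneg (d s, e s)]

namespace IsEmdenFowlerSolution

variable {θ β q T : ℝ} {f φ v₁ w₁ v₂ w₂ : ℝ → ℝ}

theorem eventually_eq (hs : IsSupercritical θ β q) (hφ : IsLowerOrder q φ)
    (h₁ : IsEmdenFowlerSolution θ β (fun u => φ u + u ^ q) T v₁ w₁)
    (h₂ : IsEmdenFowlerSolution θ β (fun u => φ u + u ^ q) T v₂ w₂) :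
    ∀ᶠ t in atBot, v₁ t = v₂ t ∧ w₁ t = w₂ t := by
  have hq : 0 < q - 1 := sub_pos.2 hs.one_lt
  have hv₁ := h₁.tendsto_equilibrium hs hφ
  have hv₂ := h₂.tendsto_equilibrium hs hφ
  set ρ := fun t => emdenFowlerSource θ (fun u => φ u + u ^ q) t (v₁ t) -
    emdenFowlerSource θ (fun u => φ u + u ^ q) t (v₂ t) - q * (θ * β) * (v₁ t - v₂ t) with hρ_def
  have hρ : ρ =o[atBot] fun t => v₁ t - v₂ t := by
    refine Asymptotics.isLittleO_iff.2 fun ε hε => ?_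
    obtain ⟨r, ⟨hr, -⟩, hsource⟩ := hφ.exists_eventually_abs_source_sub_sub_le hs.theta_pos
      hs.scaling (emdenFowlerEquilibrium_pos hs) hε
    have hnhds := Icc_mem_nhds (sub_lt_self (emdenFowlerEquilibrium θ β q) hr)
      (lt_add_of_pos_right _ hr)
    filter_upwards [hsource, hv₁ hnhds, hv₂ hnhds] with t ht ht₁ ht₂
    simpa only [emdenFowlerEquilibrium_rpow_sub_one hs, Real.norm_eq_abs] using ht _ ht₁ _ ht₂
  have hdiff := eventually_eq_zero_of_damped_oscillator (d := fun t => v₁ t - v₂ t)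
    (e := fun t => w₁ t - w₂ t) (sub_pos.2 hs.theta_lt)
    (mul_pos (mul_pos hs.theta_pos hs.beta_pos) hq)
    ((eventually_lt_atBot T).mono fun t ht => (h₁.hasDerivAt_fst t ht).sub (h₂.hasDerivAt_fst t ht))
    ((eventually_lt_atBot T).mono fun t ht => ((h₁.hasDerivAt_snd t ht).sub
      (h₂.hasDerivAt_snd t ht)).congr_deriv (by simp only [hρ_def]; ring)) hρ
    (by simpa using hv₁.sub hv₂)
    (by simpa using (h₁.tendsto_snd hs hφ).sub (h₂.tendsto_snd hs hφ))
  filter_upwards [hdiff] with t ht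
  exact ⟨sub_eq_zero.1 ht.1, sub_eq_zero.1 ht.2⟩

theorem exists_abs_source_sub_le (hf : LocallyLipschitzOn (Ioi 0) f)
    (h₁ : IsEmdenFowlerSolution θ β f T v₁ w₁) (h₂ : IsEmdenFowlerSolution θ β f T v₂ w₂)
    (t₀ : ℝ) {t₁ : ℝ} (ht₁ : t₁ < T) :
    ∃ L, ∀ t ∈ Icc t₀ t₁, |emdenFowlerSource θ f t (v₁ t) - emdenFowlerSource θ f t (v₂ t)| ≤
      L * |v₁ t - v₂ t| := by
  set y₁ := fun t => Real.exp (-θ * t) * v₁ t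
  set y₂ := fun t => Real.exp (-θ * t) * v₂ t
  have hT : ∀ t ∈ Icc t₀ t₁, t < T := fun t ht => ht.2.trans_lt ht₁
  have hcompact : IsCompact (y₁ '' Icc t₀ t₁ ∪ y₂ '' Icc t₀ t₁) := by
    refine (isCompact_Icc.image_of_continuousOn fun t ht => ?_).union
      (isCompact_Icc.image_of_continuousOn fun t ht => ?_)
    · exact (h₁.hasDerivAt_exp_mul_fst (-θ) (hT t ht)).continuousAt.continuousWithinAt
    · exact (h₂.hasDerivAt_exp_mul_fst (-θ) (hT t ht)).continuousAt.continuousWithinAt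
  have hpos : y₁ '' Icc t₀ t₁ ∪ y₂ '' Icc t₀ t₁ ⊆ Ioi 0 := by
    rintro _ (⟨t, ht, rfl⟩ | ⟨t, ht, rfl⟩)
    exacts [mul_pos (Real.exp_pos _) (h₁.pos t (hT t ht)),
      mul_pos (Real.exp_pos _) (h₂.pos t (hT t ht))]
  obtain ⟨K, hK⟩ := (hf.mono hpos).exists_lipschitzOnWith_of_compact hcompact
  refine ⟨Real.exp (2 * t₁) * K, fun t ht => ?_⟩
  have hlip := hK.norm_sub_le (Or.inl (mem_image_of_mem y₁ ht)) (Or.inr (mem_image_of_mem y₂ ht))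
  calc |emdenFowlerSource θ f t (v₁ t) - emdenFowlerSource θ f t (v₂ t)|
      = Real.exp ((θ + 2) * t) * |f (y₁ t) - f (y₂ t)| := by
        rw [emdenFowlerSource, emdenFowlerSource, ← mul_sub, abs_mul, Real.abs_exp]
    _ ≤ Real.exp ((θ + 2) * t) * (K * |y₁ t - y₂ t|) := by gcongr; exact hlip
    _ = Real.exp (2 * t) * K * |v₁ t - v₂ t| := by
        have hexp : Real.exp (2 * t) = Real.exp ((θ + 2) * t) * Real.exp (-θ * t) := by
          rw [← Real.exp_add]
          ring_nf
        rw [← mul_sub, abs_mul, Real.abs_exp, hexp]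
        ring
    _ ≤ Real.exp (2 * t₁) * K * |v₁ t - v₂ t| := by gcongr; exact ht.2

theorem eq_of_eq_of_le (hf : LocallyLipschitzOn (Ioi 0) f)
    (h₁ : IsEmdenFowlerSolution θ β f T v₁ w₁) (h₂ : IsEmdenFowlerSolution θ β f T v₂ w₂)
    {t₀ t₁ : ℝ} (hv : v₁ t₀ = v₂ t₀) (hw : w₁ t₀ = w₂ t₀) (ht : t₀ ≤ t₁) (ht₁ : t₁ < T) :
    v₁ t₁ = v₂ t₁ := by
  have hT : ∀ t ∈ Icc t₀ t₁, t < T := fun t ht => ht.2.trans_lt ht₁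
  obtain ⟨L, hL⟩ := h₁.exists_abs_source_sub_le hf h₂ t₀ ht₁
  refine sub_eq_zero.1 (eq_zero_of_abs_second_deriv_le (A := |θ * β| + L) (B := |β - θ|)
    (fun t ht => (h₁.hasDerivAt_fst t (hT t ht)).sub (h₂.hasDerivAt_fst t (hT t ht)))
    (fun t ht => (h₁.hasDerivAt_snd t (hT t ht)).sub (h₂.hasDerivAt_snd t (hT t ht)))
    (fun t ht => ?_) (sub_eq_zero.2 hv) (sub_eq_zero.2 hw) (right_mem_Icc.2 ht))
  set r := emdenFowlerSource θ f t (v₁ t) - emdenFowlerSource θ f t (v₂ t) with hr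
  calc _ = |θ * β * (v₁ t - v₂ t) - (β - θ) * (w₁ t - w₂ t) - r| := by rw [hr]; ring_nf
    _ ≤ |θ * β * (v₁ t - v₂ t)| + |(β - θ) * (w₁ t - w₂ t)| + |r| :=
        (abs_sub _ _).trans (add_le_add_left (abs_sub _ _) _)
    _ ≤ |θ * β * (v₁ t - v₂ t)| + |(β - θ) * (w₁ t - w₂ t)| + L * |v₁ t - v₂ t| :=
        add_le_add_right (hL t ht) _
    _ = (|θ * β| + L) * |v₁ t - v₂ t| + |β - θ| * |w₁ t - w₂ t| := by
        rw [abs_mul (θ * β), abs_mul (β - θ)]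
        ring

theorem unique (hs : IsSupercritical θ β q) (hφ : IsLowerOrder q φ)
    (h₁ : IsEmdenFowlerSolution θ β (fun u => φ u + u ^ q) T v₁ w₁)
    (h₂ : IsEmdenFowlerSolution θ β (fun u => φ u + u ^ q) T v₂ w₂) {t : ℝ} (ht : t < T) :
    v₁ t = v₂ t := by
  obtain ⟨t₀, ⟨hv, hw⟩, ht₀⟩ :=
    ((h₁.eventually_eq hs hφ h₂).and (eventually_le_atBot t)).exists
  exact h₁.eq_of_eq_of_le (hφ.contDiffOn_add_rpow.locallyLipschitzOn (convex_Ioi 0)) h₂ hv hw ht₀ ht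

end IsEmdenFowlerSolution

/-! ### Bounded solutions of the damped oscillator -/

section BoundedSolutions

open scoped BoundedContinuousFunction

/-- The bounded solution on the whole line of `y' = g - c y`, for `g` bounded and `0 < Re c`. -/
noncomputable def expConvolution (c : ℂ) (g : ℝ → ℂ) (t : ℝ) : ℂ :=
  Complex.exp (-(c * t)) * ∫ s in Iic t, Complex.exp (c * s) * g s

variable {c : ℂ}

theorem integrableOn_exp_mul_boundedContinuous_Iic (hc : 0 < c.re) (g : ℝ →ᵇ ℂ) (t : ℝ) :
    MeasureTheory.IntegrableOn (fun s : ℝ => Complex.exp (c * s) * g s) (Iic t) :=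
  MeasureTheory.Integrable.mul_bdd (integrableOn_exp_mul_complex_Iic hc t)
    g.continuous.aestronglyMeasurable (Eventually.of_forall g.norm_coe_le_norm)

theorem hasDerivAt_expConvolution (hc : 0 < c.re) (g : ℝ →ᵇ ℂ) (t : ℝ) :
    HasDerivAt (expConvolution c g) (g t - c * expConvolution c g t) t := by
  have hg_int := integrableOn_exp_mul_boundedContinuous_Iic hc g
  have hcont : Continuous fun s : ℝ => Complex.exp (c * s) * g s := by fun_prop
  have hintegral : HasDerivAt (fun t : ℝ => ∫ s in Iic t, Complex.exp (c * s) * g s)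
      (Complex.exp (c * t) * g t) t := by
    refine ((hcont.integral_hasStrictDerivAt 0 t).hasDerivAt.const_add
      (∫ s in Iic (0 : ℝ), Complex.exp (c * s) * g s)).congr_of_eventuallyEq
      (Eventually.of_forall fun x => ?_)
    simp only [← intervalIntegral.integral_Iic_sub_Iic (hg_int 0) (hg_int x), add_sub_cancel]
  have hexp : HasDerivAt (fun t : ℝ => Complex.exp (-(c * t)))
      (Complex.exp (-(c * t)) * -(c * 1)) t :=
    ((((hasDerivAt_id (t : ℂ)).const_mul c).neg).cexp).comp_ofReal
  refine (hexp.mul hintegral).congr_deriv ?_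
  have hinv : Complex.exp (-(c * t)) * Complex.exp (c * t) = 1 := by
    rw [← Complex.exp_add, neg_add_cancel, Complex.exp_zero]
  rw [expConvolution]
  linear_combination g t * hinv

theorem norm_expConvolution_le (hc : 0 < c.re) (g : ℝ →ᵇ ℂ) (t : ℝ) :
    ‖expConvolution c g t‖ ≤ c.re⁻¹ * ‖g‖ := by
  have hintegral : ‖∫ s in Iic t, Complex.exp (c * s) * g s‖ ≤
      Real.exp (c.re * t) / c.re * ‖g‖ := by
    rw [← integral_exp_mul_Iic hc, ← MeasureTheory.integral_mul_const]
    refine MeasureTheory.norm_integral_le_of_norm_le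
      ((integrableOn_exp_mul_Iic hc t).mul_const ‖g‖) (Eventually.of_forall fun s => ?_)
    rw [norm_mul, Complex.norm_exp, Complex.re_mul_ofReal]
    exact mul_le_mul_of_nonneg_left (g.norm_coe_le_norm s) (Real.exp_pos _).le
  rw [expConvolution, norm_mul, Complex.norm_exp, Complex.neg_re, Complex.re_mul_ofReal]
  calc Real.exp (-(c.re * t)) * ‖∫ s in Iic t, Complex.exp (c * s) * g s‖
      ≤ Real.exp (-(c.re * t)) * (Real.exp (c.re * t) / c.re * ‖g‖) := by gcongr
    _ = Real.exp (-(c.re * t)) * Real.exp (c.re * t) * (c.re⁻¹ * ‖g‖) := by ring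
    _ = c.re⁻¹ * ‖g‖ := by rw [← Real.exp_add, neg_add_cancel, Real.exp_zero, one_mul]

theorem expConvolution_sub (hc : 0 < c.re) (g₁ g₂ : ℝ →ᵇ ℂ) (t : ℝ) :
    expConvolution c g₁ t - expConvolution c g₂ t = expConvolution c (g₁ - g₂ : ℝ →ᵇ ℂ) t := by
  rw [expConvolution, expConvolution, ← mul_sub, ← MeasureTheory.integral_sub
    (integrableOn_exp_mul_boundedContinuous_Iic hc g₁ t)
    (integrableOn_exp_mul_boundedContinuous_Iic hc g₂ t), expConvolution]
  simp only [mul_sub, BoundedContinuousFunction.coe_sub, Pi.sub_apply]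

/-- `expConvolution c` as an operator on bounded continuous functions. -/
noncomputable def boundedExpConvolution (hc : 0 < c.re) (g : ℝ →ᵇ ℂ) : ℝ →ᵇ ℂ :=
  .ofNormedAddCommGroup (expConvolution c g)
    (continuous_iff_continuousAt.2 fun t => (hasDerivAt_expConvolution hc g t).continuousAt)
    (c.re⁻¹ * ‖g‖) (norm_expConvolution_le hc g)

theorem hasDerivAt_boundedExpConvolution (hc : 0 < c.re) (g : ℝ →ᵇ ℂ) (t : ℝ) :
    HasDerivAt (boundedExpConvolution hc g) (g t - c * boundedExpConvolution hc g t) t :=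
  hasDerivAt_expConvolution hc g t

theorem norm_boundedExpConvolution_le (hc : 0 < c.re) (g : ℝ →ᵇ ℂ) :
    ‖boundedExpConvolution hc g‖ ≤ c.re⁻¹ * ‖g‖ :=
  (BoundedContinuousFunction.norm_le (by positivity)).2 (norm_expConvolution_le hc g)

theorem lipschitzWith_boundedExpConvolution (hc : 0 < c.re) :
    LipschitzWith c.re⁻¹.toNNReal (boundedExpConvolution hc) := by
  refine LipschitzWith.of_dist_le_mul fun g₁ g₂ => ?_
  rw [Real.coe_toNNReal _ (by positivity), dist_eq_norm g₁]
  refine (BoundedContinuousFunction.dist_le (by positivity)).2 fun t => ?_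
  rw [dist_eq_norm]
  exact (congrArg norm (expConvolution_sub hc g₁ g₂ t)).trans_le (norm_expConvolution_le hc _ t)

theorem exists_boundedExpConvolution_fixedPoint {a b : ℂ} (ha : 0 < a.re) (hb : 0 < b.re)
    {F : ℝ → ℂ → ℂ} {C K : ℝ} (hF : Continuous (Function.uncurry F)) (hC : ∀ t z, ‖F t z‖ ≤ C)
    (hLip : ∀ t z z', ‖F t z - F t z'‖ ≤ K * ‖z - z'‖) (hK : K < a.re * b.re) :
    ∃ x g : ℝ →ᵇ ℂ, (∀ t, g t = F t (x t)) ∧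
      x = boundedExpConvolution ha (boundedExpConvolution hb g) := by
  let N : (ℝ →ᵇ ℂ) → (ℝ →ᵇ ℂ) := fun x => .ofNormedAddCommGroup (fun t => F t (x t))
    (hF.comp (continuous_id.prodMk x.continuous)) C fun t => hC t (x t)
  have hN : LipschitzWith K.toNNReal N := by
    refine LipschitzWith.of_dist_le_mul fun x y => ?_
    refine (BoundedContinuousFunction.dist_le (by positivity)).2 fun t => ?_
    rw [dist_eq_norm]
    refine (hLip t (x t) (y t)).trans (mul_le_mul (Real.le_coe_toNNReal K) ?_ (norm_nonneg _)
      K.toNNReal.coe_nonneg)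
    rw [← dist_eq_norm]
    exact BoundedContinuousFunction.dist_coe_le_dist t
  have hcontr : ContractingWith (a.re⁻¹.toNNReal * (b.re⁻¹.toNNReal * K.toNNReal))
      (boundedExpConvolution ha ∘ boundedExpConvolution hb ∘ N) := by
    refine ⟨?_, (lipschitzWith_boundedExpConvolution ha).comp
      ((lipschitzWith_boundedExpConvolution hb).comp hN)⟩
    rw [← Real.toNNReal_mul (by positivity), ← Real.toNNReal_mul (by positivity),
      Real.toNNReal_lt_one, ← mul_assoc, ← mul_inv, inv_mul_lt_one₀ (by positivity)]
    exact hK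
  exact ⟨hcontr.fixedPoint, N hcontr.fixedPoint, fun t => rfl,
    hcontr.fixedPoint_isFixedPt.symm⟩

theorem exists_add_eq_mul_eq_re_pos {α κ : ℝ} (hα : 0 < α) (hκ : 0 < κ) :
    ∃ a b : ℂ, a + b = α ∧ a * b = κ ∧ 0 < a.re ∧ 0 < b.re := by
  obtain ⟨s, hs, hsα⟩ : ∃ s : ℂ, s ^ 2 = ((α ^ 2 / 4 - κ : ℝ) : ℂ) ∧ |s.re| < α / 2 := by
    rcases le_or_gt 0 (α ^ 2 / 4 - κ) with hdisc | hdisc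
    · refine ⟨(√(α ^ 2 / 4 - κ) : ℝ), ?_, ?_⟩
      · rw [← Complex.ofReal_pow, Real.sq_sqrt hdisc]
      · rw [Complex.ofReal_re, abs_of_nonneg (Real.sqrt_nonneg _), Real.sqrt_lt' (by positivity)]
        linarith
    · refine ⟨(√(-(α ^ 2 / 4 - κ)) : ℝ) * Complex.I, ?_, ?_⟩
      · rw [mul_pow, ← Complex.ofReal_pow, Real.sq_sqrt (by linarith), Complex.I_sq]
        push_cast
        ring
      · simpa using hα
  rw [abs_lt] at hsα
  refine ⟨((α / 2 : ℝ) : ℂ) + s, ((α / 2 : ℝ) : ℂ) - s, ?_, ?_, ?_, ?_⟩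
  · push_cast
    ring
  · push_cast at hs ⊢
    linear_combination -hs
  · rw [Complex.add_re, Complex.ofReal_re]
    linarith [hsα.1]
  · rw [Complex.sub_re, Complex.ofReal_re]
    linarith [hsα.2]

theorem hasDerivAt_re {f : ℝ → ℂ} {f' : ℂ} {t : ℝ} (hf : HasDerivAt f f' t) :
    HasDerivAt (fun s => (f s).re) f'.re t :=
  Complex.reCLM.hasFDerivAt.comp_hasDerivAt t hf

/-- With `a` and `b` the roots of `X ^ 2 - α X + κ`, the equation is
`(d/dt + b) (d/dt + a) x = H t x`. -/
theorem exists_bounded_solution {α κ : ℝ} (hα : 0 < α) (hκ : 0 < κ) :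
    ∃ c > 0, ∀ (H : ℝ → ℝ → ℝ) (C K : ℝ), Continuous (Function.uncurry H) →
      (∀ t x, |H t x| ≤ C) → (∀ t x y, |H t x - H t y| ≤ K * |x - y|) → 0 ≤ K → K < c →
      ∃ x w : ℝ → ℝ, (∀ t, HasDerivAt x (w t) t) ∧
        (∀ t, HasDerivAt w (H t (x t) - α * w t - κ * x t) t) ∧ ∀ t, |x t| ≤ C / c := by
  obtain ⟨a, b, hsum, hprod, ha, hb⟩ := exists_add_eq_mul_eq_re_pos hα hκ
  refine ⟨a.re * b.re, by positivity, fun H C K hH hC hLip hK0 hK => ?_⟩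
  obtain ⟨x, g, hg, hx⟩ := exists_boundedExpConvolution_fixedPoint ha hb
    (F := fun t z => (H t z.re : ℂ)) (C := C) (K := K)
    (Complex.continuous_ofReal.comp
      (hH.comp (continuous_fst.prodMk (Complex.continuous_re.comp continuous_snd))))
    (fun t z => by simpa only [Complex.norm_real, Real.norm_eq_abs] using hC t z.re)
    (fun t z z' => by
      rw [← Complex.ofReal_sub, Complex.norm_real]
      refine (hLip t z.re z'.re).trans (mul_le_mul_of_nonneg_left ?_ hK0)
      exact Complex.abs_re_le_norm (z - z')) hK
  set y := boundedExpConvolution hb g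
  have hx' : ∀ t, HasDerivAt x (y t - a * x t) t := fun t => by
    rw [hx]
    exact hasDerivAt_boundedExpConvolution ha y t
  have hy' : ∀ t, HasDerivAt y (g t - b * y t) t := hasDerivAt_boundedExpConvolution hb g
  refine ⟨fun t => (x t).re, fun t => (y t - a * x t).re, fun t => hasDerivAt_re (hx' t),
    fun t => ?_, fun t => ?_⟩
  · refine (hasDerivAt_re ((hy' t).sub ((hx' t).const_mul a))).congr_deriv ?_
    have hfactor : g t - b * y t - a * (y t - a * x t) =
        (H t (x t).re : ℂ) - (α : ℂ) * (y t - a * x t) - (κ : ℂ) * x t := by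
      rw [← hsum, ← hprod, hg]
      ring
    rw [hfactor, Complex.sub_re, Complex.sub_re, Complex.re_ofReal_mul, Complex.re_ofReal_mul,
      Complex.ofReal_re]
  · have hgC : ‖g‖ ≤ C := (BoundedContinuousFunction.norm_le ((abs_nonneg _).trans (hC 0 0))).2
      fun t => by simpa only [hg, Complex.norm_real, Real.norm_eq_abs] using hC t (x t).re
    calc |(x t).re| ≤ ‖x‖ := (Complex.abs_re_le_norm _).trans (x.norm_coe_le_norm t)
      _ ≤ a.re⁻¹ * (b.re⁻¹ * C) := by
        rw [hx]
        refine (norm_boundedExpConvolution_le ha y).trans ?_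
        gcongr
        exact (norm_boundedExpConvolution_le hb g).trans (by gcongr)
      _ = C / (a.re * b.re) := by rw [div_eq_mul_inv, mul_inv]; ring

end BoundedSolutions

theorem exists_small_solution {α κ : ℝ} (hα : 0 < α) (hκ : 0 < κ) :
    ∃ c > 0, ∀ (H : ℝ → ℝ → ℝ) (T r : ℝ), 0 ≤ r →
      ContinuousOn (Function.uncurry H) (Iic T ×ˢ Icc (-r) r) → (∀ t ≤ T, |H t 0| ≤ c * r) →
      (∀ t ≤ T, ∀ x ∈ Icc (-r) r, ∀ y ∈ Icc (-r) r, |H t x - H t y| ≤ c * |x - y|) →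
      ∃ x w : ℝ → ℝ, (∀ t, HasDerivAt x (w t) t) ∧
        (∀ t ≤ T, HasDerivAt w (H t (x t) - α * w t - κ * x t) t) ∧
        ∀ t, x t ∈ Icc (-r) r := by
  obtain ⟨c, hc, hsolve⟩ := exists_bounded_solution hα hκ
  refine ⟨c / 2, by positivity, fun H T r hr hH hH0 hLip => ?_⟩
  have hrr : -r ≤ r := neg_le_self hr
  have h0 : (0 : ℝ) ∈ Icc (-r) r := ⟨neg_nonpos.2 hr, hr⟩
  set P : ℝ → ℝ := fun x => projIcc (-r) r hrr x with hP_def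
  have hP : ∀ x, P x ∈ Icc (-r) r := fun x => (projIcc (-r) r hrr x).2
  have hcont : Continuous (Function.uncurry fun t x => H (min t T) (P x)) := by
    refine hH.comp_continuous (f := fun z : ℝ × ℝ => (min z.1 T, P z.2)) ?_
      fun z => mk_mem_prod (mem_Iic.2 (min_le_right _ _)) (hP z.2)
    exact (continuous_fst.min continuous_const).prodMk
      (continuous_subtype_val.comp (continuous_projIcc.comp continuous_snd))
  have hP_lip : ∀ x y, |P x - P y| ≤ |x - y| := fun x y => abs_projIcc_sub_projIcc hrr
  have hbound : ∀ t x, |H (min t T) (P x)| ≤ c * r := fun t x => by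
    have hdiff := hLip (min t T) (min_le_right _ _) (P x) (hP x) 0 h0
    have htri := abs_add_le (H (min t T) (P x) - H (min t T) 0) (H (min t T) 0)
    rw [sub_add_cancel] at htri
    have hPx : c / 2 * |P x - 0| ≤ c / 2 * r := by
      rw [sub_zero]
      exact mul_le_mul_of_nonneg_left (abs_le.2 (hP x)) (by positivity)
    linarith [hH0 (min t T) (min_le_right _ _)]
  obtain ⟨x, w, hx, hw, hxr⟩ := hsolve (fun t x => H (min t T) (P x)) (c * r) (c / 2) hcont
    hbound (fun t x y => (hLip (min t T) (min_le_right _ _) (P x) (hP x) (P y) (hP y)).trans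
      (mul_le_mul_of_nonneg_left (hP_lip x y) (by positivity))) (by positivity) (half_lt_self hc)
  replace hxr : ∀ t, x t ∈ Icc (-r) r := fun t => by
    simpa only [mul_div_cancel_left₀ r hc.ne', abs_le, mem_Icc] using hxr t
  refine ⟨x, w, hx, fun t ht => ?_, hxr⟩
  simpa only [min_eq_left ht, hP_def, projIcc_of_mem hrr (hxr t)] using hw t

/-! ### Existence -/

theorem IsLowerOrder.tendsto_emdenFowlerSource {θ q x : ℝ} {φ : ℝ → ℝ} (hφ : IsLowerOrder q φ)
    (hθ : 0 < θ) (hscaling : θ * (q - 1) = 2) (hx : 0 < x) :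
    Tendsto (fun t => emdenFowlerSource θ φ t x) atBot (𝓝 0) := by
  obtain ⟨δ, hδ, hO⟩ := hφ.exists_source_isBigO hθ hscaling
  refine (hO (fun _ => x) (Eventually.of_forall fun _ => hx)
    (Asymptotics.isBigO_const_const x one_ne_zero atBot)
    (tendsto_exp_neg_mul_mul_const hθ hx)).trans_tendsto ?_
  simpa using (tendsto_exp_mul_atBot hδ).mul_const x

section Existence

variable {θ β q : ℝ}

theorem isEmdenFowlerSolution_const (hs : IsSupercritical θ β q) (T : ℝ) :
    IsEmdenFowlerSolution θ β (fun u => u ^ q) T (fun _ => emdenFowlerEquilibrium θ β q)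
      (fun _ => 0) where
  pos _ _ := emdenFowlerEquilibrium_pos hs
  hasDerivAt_fst _ _ := hasDerivAt_const _ _
  hasDerivAt_snd t _ := (hasDerivAt_const t 0).congr_deriv <| by
    rw [emdenFowlerSource_rpow hs.scaling (emdenFowlerEquilibrium_pos hs).le,
      emdenFowlerEquilibrium_rpow hs]
    ring
  singular := tendsto_exp_neg_mul_mul_const hs.theta_pos (emdenFowlerEquilibrium_pos hs)

/-- The solution is sought as `x₀ + x` with `x₀` the equilibrium and `x` small; linearising the
source at `x₀` leaves a forced oscillator for `x`. -/
theorem exists_isEmdenFowlerSolution {φ : ℝ → ℝ} (hs : IsSupercritical θ β q)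
    (hφ : IsLowerOrder q φ) :
    ∃ (T : ℝ) (v w : ℝ → ℝ), IsEmdenFowlerSolution θ β (fun u => φ u + u ^ q) T v w := by
  have hx₀ := emdenFowlerEquilibrium_pos hs
  have heq := emdenFowlerEquilibrium_rpow hs
  have hslope := emdenFowlerEquilibrium_rpow_sub_one hs
  set x₀ := emdenFowlerEquilibrium θ β q
  obtain ⟨c, hc, hsolve⟩ := exists_small_solution (sub_pos.2 hs.theta_lt)
    (mul_pos (mul_pos hs.theta_pos hs.beta_pos) (sub_pos.2 hs.one_lt))
  obtain ⟨r, ⟨hr, hrx₀⟩, hlinear⟩ := hφ.exists_eventually_abs_source_sub_sub_le hs.theta_pos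
    hs.scaling hx₀ hc
  have hsource := hφ.tendsto_emdenFowlerSource hs.theta_pos hs.scaling hx₀
  obtain ⟨T, hT⟩ := eventually_atBot.1 (hlinear.and
    (hsource.abs.eventually_le_const (by simpa using mul_pos hc hr)))
  set S := emdenFowlerSource θ (fun u => φ u + u ^ q) with hS
  have hSx₀ : ∀ t, θ * β * x₀ - S t x₀ = -emdenFowlerSource θ φ t x₀ := fun t => by
    rw [hS, emdenFowlerSource_add_rpow hs.scaling φ hx₀.le, heq]
    ring
  have hmem : ∀ x ∈ Icc (-r) r, x₀ + x ∈ Icc (x₀ - r) (x₀ + r) := fun x hx =>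
    ⟨by linarith [hx.1], by linarith [hx.2]⟩
  have hScont : ContinuousOn (Function.uncurry fun t x => S t (x₀ + x))
      (Iic T ×ˢ Icc (-r) r) :=
    (continuousOn_emdenFowlerSource hφ.contDiffOn_add_rpow.continuousOn θ).comp
      (f := fun z : ℝ × ℝ => (z.1, x₀ + z.2)) (by fun_prop)
      fun z hz => ⟨mem_univ _, (sub_pos.2 hrx₀).trans_le (hmem _ hz.2).1⟩
  obtain ⟨x, w, hx, hw, hxr⟩ := hsolve
    (fun t x => θ * β * x₀ + q * (θ * β) * x - S t (x₀ + x)) T r hr.le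
    (ContinuousOn.sub (by fun_prop) hScont)
    (fun t ht => by simpa only [mul_zero, add_zero, hSx₀, abs_neg] using (hT t ht).2)
    (fun t ht x hx y hy => by
      have h := (hT t ht).1 (x₀ + x) (hmem x hx) (x₀ + y) (hmem y hy)
      rw [hslope, add_sub_add_left_eq_sub, ← abs_neg] at h
      convert h using 2
      ring)
  have hlower : ∀ t, x₀ - r ≤ x₀ + x t := fun t => (hmem _ (hxr t)).1
  refine ⟨T, fun t => x₀ + x t, w, fun t _ => (sub_pos.2 hrx₀).trans_le (hlower t),
    fun t _ => (hx t).const_add x₀, fun t ht => (hw t ht.le).congr_deriv (by ring), ?_⟩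
  exact tendsto_atTop_mono (fun t => mul_le_mul_of_nonneg_left (hlower t) (Real.exp_pos _).le)
    (tendsto_exp_neg_mul_mul_const hs.theta_pos (sub_pos.2 hrx₀))

end Existence

/-! ### Singular solutions of the radial equation -/

theorem contDiffOn_two_of_hasDerivAt {s : Set ℝ} (hs : IsOpen s) {u u₁ u₂ : ℝ → ℝ}
    (h₁ : ∀ r ∈ s, HasDerivAt u (u₁ r) r) (h₂ : ∀ r ∈ s, HasDerivAt u₁ (u₂ r) r)
    (hu₂ : ContinuousOn u₂ s) : ContDiffOn ℝ 2 u s := by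
  have hu₁ : ContDiffOn ℝ 1 u₁ s := (contDiffOn_succ_iff_deriv_of_isOpen (n := 0) hs).2
    ⟨fun r hr => (h₂ r hr).differentiableAt.differentiableWithinAt, by simp,
      contDiffOn_zero.2 (hu₂.congr fun r hr => (h₂ r hr).deriv)⟩
  exact (contDiffOn_succ_iff_deriv_of_isOpen (n := 1) hs).2
    ⟨fun r hr => (h₁ r hr).differentiableAt.differentiableWithinAt, by simp,
      hu₁.congr fun r hr => (h₁ r hr).deriv⟩

theorem hasDerivAt_rpow_mul_comp_log {g : ℝ → ℝ} {g' r : ℝ} (a : ℝ) (hr : 0 < r)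
    (hg : HasDerivAt g g' (Real.log r)) :
    HasDerivAt (fun x => x ^ a * g (Real.log x))
      (r ^ (a - 1) * (a * g (Real.log r) + g')) r := by
  refine ((Real.hasDerivAt_rpow_const (p := a) (Or.inl hr.ne')).mul
    (hg.comp r (Real.hasDerivAt_log hr.ne'))).congr_deriv ?_
  rw [Real.rpow_sub_one hr.ne']
  simp only [Function.comp_apply]
  field_simp

section EmdenFowlerTransform

variable {n : ℕ} {θ β R T r : ℝ} {f u v w : ℝ → ℝ}

namespace IsSingularSolution

theorem hasDerivAt (h : IsSingularSolution n f R u) (hr : r ∈ Ioo 0 R) :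
    HasDerivAt u (deriv u r) r :=
  ((h.contDiffOn.differentiableOn two_ne_zero).differentiableAt
    (isOpen_Ioo.mem_nhds hr)).hasDerivAt

theorem hasDerivAt_deriv (h : IsSingularSolution n f R u) (hr : r ∈ Ioo 0 R) :
    HasDerivAt (deriv u) (deriv (deriv u) r) r :=
  (((contDiffOn_succ_iff_deriv_of_isOpen (n := 1) isOpen_Ioo).1 h.contDiffOn).2.2.differentiableOn
    one_ne_zero |>.differentiableAt (isOpen_Ioo.mem_nhds hr)).hasDerivAt

theorem isEmdenFowlerSolution (h : IsSingularSolution n f R u) (θ : ℝ) :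
    IsEmdenFowlerSolution θ ((n : ℝ) - 2 - θ) f (Real.log R)
      (fun t => Real.exp (θ * t) * u (Real.exp t))
      (fun t => Real.exp (θ * t) *
        (θ * u (Real.exp t) + Real.exp t * deriv u (Real.exp t))) := by
  have hmem : ∀ t < Real.log R, Real.exp t ∈ Ioo 0 R := fun t ht =>
    ⟨Real.exp_pos t, (Real.lt_log_iff_exp_lt h.radius_pos).1 ht⟩
  have hcancel : ∀ t x, Real.exp (-θ * t) * (Real.exp (θ * t) * x) = x := fun t x => by
    rw [← mul_assoc, ← Real.exp_add, neg_mul, neg_add_cancel, Real.exp_zero, one_mul]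
  refine ⟨fun t ht => mul_pos (Real.exp_pos _) (h.pos _ (hmem t ht)), fun t ht => ?_,
    fun t ht => ?_, ?_⟩
  · refine ((hasDerivAt_exp_mul θ t).mul
      ((h.hasDerivAt (hmem t ht)).comp t (Real.hasDerivAt_exp t))).congr_deriv ?_
    simp only [Function.comp_apply]
    ring
  · have hu := (h.hasDerivAt (hmem t ht)).comp t (Real.hasDerivAt_exp t)
    have hu' := (h.hasDerivAt_deriv (hmem t ht)).comp t (Real.hasDerivAt_exp t)
    refine ((hasDerivAt_exp_mul θ t).mul
      ((hu.const_mul θ).add ((Real.hasDerivAt_exp t).mul hu'))).congr_deriv ?_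
    have hexp : Real.exp ((θ + 2) * t) = Real.exp (θ * t) * Real.exp t ^ 2 := by
      rw [← Real.exp_nat_mul, ← Real.exp_add, add_mul, Nat.cast_ofNat]
    have hdiv : Real.exp t ^ 2 * (((n : ℝ) - 1) / Real.exp t) = ((n : ℝ) - 1) * Real.exp t := by
      field_simp
    rw [emdenFowlerSource, hcancel, hexp]
    simp only [Function.comp_apply, Pi.add_apply, Pi.mul_apply]
    linear_combination Real.exp (θ * t) * Real.exp t ^ 2 * h.equation _ (hmem t ht) -
      Real.exp (θ * t) * deriv u (Real.exp t) * hdiv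
  · exact (h.singular.comp Real.tendsto_exp_atBot_nhdsGT).congr fun t => (hcancel t _).symm

end IsSingularSolution

namespace IsEmdenFowlerSolution

theorem hasDerivAt_rpow_mul_fst (h : IsEmdenFowlerSolution θ β f T v w)
    (hr : r ∈ Ioo 0 (Real.exp T)) :
    HasDerivAt (fun r => r ^ (-θ) * v (Real.log r))
      (r ^ (-θ - 1) * (-θ * v (Real.log r) + w (Real.log r))) r :=
  hasDerivAt_rpow_mul_comp_log (-θ) hr.1
    (h.hasDerivAt_fst _ ((Real.log_lt_iff_lt_exp hr.1).2 hr.2))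

theorem hasDerivAt_rpow_mul_snd (h : IsEmdenFowlerSolution θ β f T v w)
    (hr : r ∈ Ioo 0 (Real.exp T)) :
    HasDerivAt (fun r => r ^ (-θ - 1) * (-θ * v (Real.log r) + w (Real.log r)))
      (r ^ (-θ - 2) * (θ * (β + θ + 1) * v (Real.log r) - (β + θ + 1) * w (Real.log r)) -
        f (r ^ (-θ) * v (Real.log r))) r := by
  have hlog := (Real.log_lt_iff_lt_exp hr.1).2 hr.2
  refine (hasDerivAt_rpow_mul_comp_log (g := fun t => -θ * v t + w t) (-θ - 1) hr.1
    (((h.hasDerivAt_fst _ hlog).const_mul (-θ)).add (h.hasDerivAt_snd _ hlog))).congr_deriv ?_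
  have hsource : r ^ (-θ - 2) * emdenFowlerSource θ f (Real.log r) (v (Real.log r)) =
      f (r ^ (-θ) * v (Real.log r)) := by
    rw [emdenFowlerSource, mul_comm (θ + 2), mul_comm (-θ), ← Real.rpow_def_of_pos hr.1,
      ← Real.rpow_def_of_pos hr.1, ← mul_assoc, ← Real.rpow_add hr.1]
    simp
  rw [show -θ - 1 - 1 = -θ - 2 by ring]
  linear_combination -hsource

theorem isSingularSolution (h : IsEmdenFowlerSolution θ ((n : ℝ) - 2 - θ) f T v w)
    (hf : ContinuousOn f (Ioi 0)) :
    IsSingularSolution n f (Real.exp T) (fun r => r ^ (-θ) * v (Real.log r)) := by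
  have hpos : ∀ r ∈ Ioo 0 (Real.exp T), 0 < r ^ (-θ) * v (Real.log r) := fun r hr =>
    mul_pos (Real.rpow_pos_of_pos hr.1 _) (h.pos _ ((Real.log_lt_iff_lt_exp hr.1).2 hr.2))
  refine ⟨Real.exp_pos T, hpos,
    contDiffOn_two_of_hasDerivAt isOpen_Ioo (fun r hr => h.hasDerivAt_rpow_mul_fst hr)
      (fun r hr => h.hasDerivAt_rpow_mul_snd hr) fun r hr => ?_, fun r hr => ?_, ?_⟩
  · have hlog := (Real.log_lt_iff_lt_exp hr.1).2 hr.2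
    have hlog_cont := Real.continuousAt_log hr.1.ne'
    have hv : ContinuousAt (fun r => v (Real.log r)) r :=
      ContinuousAt.comp (h.hasDerivAt_fst _ hlog).continuousAt hlog_cont
    have hw : ContinuousAt (fun r => w (Real.log r)) r :=
      ContinuousAt.comp (h.hasDerivAt_snd _ hlog).continuousAt hlog_cont
    have hfu : ContinuousAt (fun r => f (r ^ (-θ) * v (Real.log r))) r :=
      ContinuousAt.comp (f := fun r => r ^ (-θ) * v (Real.log r))
        (hf.continuousAt (Ioi_mem_nhds (hpos r hr))) (h.hasDerivAt_rpow_mul_fst hr).continuousAt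
    have hrpow := Real.continuousAt_rpow_const r (-θ - 2) (Or.inl hr.1.ne')
    exact ((hrpow.mul ((hv.const_mul _).sub (hw.const_mul _))).sub hfu).continuousWithinAt
  · have hderiv : deriv (fun r => r ^ (-θ) * v (Real.log r)) =ᶠ[𝓝 r]
        fun r => r ^ (-θ - 1) * (-θ * v (Real.log r) + w (Real.log r)) := by
      filter_upwards [isOpen_Ioo.mem_nhds hr] with s hs
      exact (h.hasDerivAt_rpow_mul_fst hs).deriv
    rw [hderiv.deriv_eq, (h.hasDerivAt_rpow_mul_snd hr).deriv, hderiv.self_of_nhds,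
      show -θ - 2 = -θ - 1 - 1 by ring, Real.rpow_sub_one hr.1.ne' (-θ - 1)]
    ring
  · refine (h.singular.comp Real.tendsto_log_nhdsGT_zero).congr' ?_
    filter_upwards [self_mem_nhdsWithin] with r hr
    rw [Function.comp_apply, mul_comm (-θ), ← Real.rpow_def_of_pos hr]

end IsEmdenFowlerSolution

end EmdenFowlerTransform

section Supercritical

variable {n : ℕ} {q : ℝ} {φ : ℝ → ℝ}

theorem isSupercritical_of_lt (hn : 3 ≤ n) (hq : ((n : ℝ) + 2) / ((n : ℝ) - 2) < q) :
    IsSupercritical (2 / (q - 1)) ((n : ℝ) - 2 - 2 / (q - 1)) q := by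
  have hn2 : (0 : ℝ) < (n : ℝ) - 2 := by
    have : (3 : ℝ) ≤ n := by exact_mod_cast hn
    linarith
  rw [div_lt_iff₀ hn2] at hq
  have hq1 : 0 < q - 1 := pos_of_mul_pos_left (by linarith : 0 < (q - 1) * ((n : ℝ) - 2)) hn2.le
  refine ⟨by positivity, ?_, div_mul_cancel₀ _ hq1.ne'⟩
  have htheta : 2 / (q - 1) * 2 < (n : ℝ) - 2 := by
    rw [div_mul_eq_mul_div, div_lt_iff₀ hq1]
    linarith
  linarith

theorem laneEmdenSingular_eq (hq : q ≠ 1) :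
    laneEmdenSingular n q = fun r => r ^ (-(2 / (q - 1))) *
      emdenFowlerEquilibrium (2 / (q - 1)) ((n : ℝ) - 2 - 2 / (q - 1)) q := by
  have hq1 : q - 1 ≠ 0 := sub_ne_zero.2 hq
  have hB : laneEmdenB n q = 2 / (q - 1) * ((n : ℝ) - 2 - 2 / (q - 1)) := by
    rw [laneEmdenB]
    field_simp
    ring
  funext r
  rw [laneEmdenSingular, hB, neg_div, mul_comm, emdenFowlerEquilibrium]

theorem isSingularSolution_laneEmdenSingular (hn : 3 ≤ n)
    (hq : ((n : ℝ) + 2) / ((n : ℝ) - 2) < q) {R : ℝ} (hR : 0 < R) :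
    IsSingularSolution n (fun u => u ^ q) R (laneEmdenSingular n q) := by
  have hs := isSupercritical_of_lt hn hq
  have h := (isEmdenFowlerSolution_const hs (Real.log R)).isSingularSolution
    fun x hx => (Real.continuousAt_rpow_const x q (Or.inl hx.ne')).continuousWithinAt
  rwa [Real.exp_log hR, ← laneEmdenSingular_eq hs.one_lt.ne'] at h

theorem exists_isSingularSolution (hn : 3 ≤ n) (hq : ((n : ℝ) + 2) / ((n : ℝ) - 2) < q)
    (hφ : IsLowerOrder q φ) :
    ∃ (R : ℝ) (W : ℝ → ℝ), IsSingularSolution n (fun u => φ u + u ^ q) R W := by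
  obtain ⟨T, v, w, h⟩ := exists_isEmdenFowlerSolution (isSupercritical_of_lt hn hq) hφ
  exact ⟨_, _, h.isSingularSolution hφ.contDiffOn_add_rpow.continuousOn⟩

namespace IsSingularSolution

theorem eqOn (hn : 3 ≤ n) (hq : ((n : ℝ) + 2) / ((n : ℝ) - 2) < q) (hφ : IsLowerOrder q φ)
    {R₁ R₂ : ℝ} {u₁ u₂ : ℝ → ℝ} (h₁ : IsSingularSolution n (fun u => φ u + u ^ q) R₁ u₁)
    (h₂ : IsSingularSolution n (fun u => φ u + u ^ q) R₂ u₂) :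
    EqOn u₁ u₂ (Ioo 0 (min R₁ R₂)) := by
  intro r hr
  have hR := lt_min h₁.radius_pos h₂.radius_pos
  have h := IsEmdenFowlerSolution.unique (isSupercritical_of_lt hn hq) hφ
    ((h₁.isEmdenFowlerSolution _).mono (Real.log_le_log hR (min_le_left R₁ R₂)))
    ((h₂.isEmdenFowlerSolution _).mono (Real.log_le_log hR (min_le_right R₁ R₂)))
    (Real.log_lt_log hr.1 hr.2)
  rw [Real.exp_log hr.1] at h
  exact mul_left_cancel₀ (Real.exp_pos _).ne' h

theorem eqOn_laneEmdenSingular (hn : 3 ≤ n) (hq : ((n : ℝ) + 2) / ((n : ℝ) - 2) < q)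
    {R : ℝ} {u : ℝ → ℝ} (h : IsSingularSolution n (fun u => u ^ q) R u) :
    EqOn u (laneEmdenSingular n q) (Ioo 0 R) := by
  have h₀ := isSingularSolution_laneEmdenSingular hn hq h.radius_pos
  rw [← min_self R]
  refine eqOn hn hq (isLowerOrder_zero (isSupercritical_of_lt hn hq).one_lt) ?_ ?_
  · simpa only [zero_add] using h
  · simpa only [zero_add] using h₀

theorem tendsto_div_laneEmdenSingular (hn : 3 ≤ n) (hq : ((n : ℝ) + 2) / ((n : ℝ) - 2) < q)
    (hφ : IsLowerOrder q φ) {R : ℝ} {u : ℝ → ℝ}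
    (h : IsSingularSolution n (fun u => φ u + u ^ q) R u) :
    Tendsto (fun r => u r / laneEmdenSingular n q r) (𝓝[>] 0) (𝓝 1) := by
  have hs := isSupercritical_of_lt hn hq
  have hlim := ((h.isEmdenFowlerSolution _).tendsto_equilibrium hs hφ).div_const
    (emdenFowlerEquilibrium (2 / (q - 1)) ((n : ℝ) - 2 - 2 / (q - 1)) q)
  rw [div_self (emdenFowlerEquilibrium_pos hs).ne'] at hlim
  refine (hlim.comp Real.tendsto_log_nhdsGT_zero).congr' ?_
  filter_upwards [self_mem_nhdsWithin] with r hr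
  have hr0 : 0 < r := hr
  rw [Function.comp_apply, Real.exp_log hr0, mul_comm (2 / (q - 1)), ← Real.rpow_def_of_pos hr0]
  simp only [laneEmdenSingular_eq hs.one_lt.ne', Real.rpow_neg hr0.le]
  field_simp

end IsSingularSolution

end Supercritical

theorem mainTheorem5_general (n : ℕ) (hn : 3 ≤ n) {q : ℝ} {φ : ℝ → ℝ}
    (hqc : ((n : ℝ) + 2) / ((n : ℝ) - 2) < q) (hφ : IsLowerOrder q φ) :
    (∃ (R : ℝ) (W : ℝ → ℝ), IsSingularSolution n (fun u => φ u + u ^ q) R W) ∧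
    (∀ (R₁ R₂ : ℝ) (W₁ W₂ : ℝ → ℝ),
      IsSingularSolution n (fun u => φ u + u ^ q) R₁ W₁ →
      IsSingularSolution n (fun u => φ u + u ^ q) R₂ W₂ →
      EqOn W₁ W₂ (Ioo 0 (min R₁ R₂))) ∧
    (∀ R : ℝ, 0 < R → IsSingularSolution n (fun u => u ^ q) R (laneEmdenSingular n q)) ∧
    (∀ (R : ℝ) (w : ℝ → ℝ), IsSingularSolution n (fun u => u ^ q) R w →
      EqOn w (laneEmdenSingular n q) (Ioo 0 R)) ∧
    (∀ (R : ℝ) (W₀ : ℝ → ℝ), IsSingularSolution n (fun u => φ u + u ^ q) R W₀ →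
      Tendsto (fun r => W₀ r / laneEmdenSingular n q r) (𝓝[>] 0) (𝓝 1)) :=
  ⟨exists_isSingularSolution hn hqc hφ,
    fun _ _ _ _ h₁ h₂ => h₁.eqOn hn hqc hφ h₂,
    fun _ hR => isSingularSolution_laneEmdenSingular hn hqc hR,
    fun _ _ h => h.eqOn_laneEmdenSingular hn hqc,
    fun _ _ h => h.tendsto_div_laneEmdenSingular hn hqc hφ⟩

theorem mainTheorem5 (n : ℕ) (hn : 3 ≤ n) (p q : ℝ) (hp : 1 < p)
    (hpc : p < ((n : ℝ) + 2) / ((n : ℝ) - 2)) (hqc : ((n : ℝ) + 2) / ((n : ℝ) - 2) < q) :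
    -- the two-power equation has a singular solution near `0`, and only one
    (∃ (R : ℝ) (W : ℝ → ℝ), IsSingularSolution n (fun u => u ^ p + u ^ q) R W) ∧
    (∀ (R₁ R₂ : ℝ) (W₁ W₂ : ℝ → ℝ),
      IsSingularSolution n (fun u => u ^ p + u ^ q) R₁ W₁ →
      IsSingularSolution n (fun u => u ^ p + u ^ q) R₂ W₂ →
      EqOn W₁ W₂ (Ioo 0 (min R₁ R₂))) ∧
    -- `w₀` is the singular solution of the pure power equation
    (∀ R : ℝ, 0 < R → IsSingularSolution n (fun u => u ^ q) R (laneEmdenSingular n q)) ∧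
    (∀ (R : ℝ) (w : ℝ → ℝ), IsSingularSolution n (fun u => u ^ q) R w →
      EqOn w (laneEmdenSingular n q) (Ioo 0 R)) ∧
    -- the two are asymptotic at `0`
    (∀ (R : ℝ) (W₀ : ℝ → ℝ), IsSingularSolution n (fun u => u ^ p + u ^ q) R W₀ →
      Tendsto (fun r => W₀ r / laneEmdenSingular n q r) (𝓝[>] 0) (𝓝 1)) :=
  mainTheorem5_general n hn hqc (isLowerOrder_rpow (hp.trans (hpc.trans hqc)) (hpc.trans hqc))
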